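/- **Setting.** Let $q$ be a power of a prime $p$, $\omega=e^{2\pi i/p}$, $\mathrm{tr}:\mathbb F_q\to\mathbb F_p$ the trace, and let $n,k,t\ge 1$ be integers with $\frac n2\le k+t-1<n$. Put $c=n-k-t+1$, $\beta=\mathrm{lcm}(c,k)/k$, $\rho=\mathrm{lcm}(c,k)/c$. *Codes.* For codes $\mathcal A,\mathcal B\subseteq\mathbb F_q^N$, $\mathcal A\star\mathcal B$ is the span of the componentwise products $a\star b$, $a\in\mathcal A$, $b\in\mathcal B$; an $[n,\kappa]$ GRS code is a code $\{(v_sf(\alpha_s))_{s\in[n]}:\deg f<\kappa\}$ with $\kappa\le n$, pairwise distinct $\alpha_s\in\mathbb F_q$ and nonzero $v_s\in\mathbb F_q$. Let $\mathcal C'$ be an $[n,k]$ GRS code and $\mathcal D'$ an $[n,t]$ GRS code over $\mathbb F_q$ such that $\mathcal S'=\mathcal C'\star\mathcal D'$ is an $[n,k+t-1]$ GRS code with $\mathcal S'^\perp\subseteq\mathcal S'$. Let $G_{\mathcal C'},G_{\mathcal D'}$ be generator matrices of $\mathcal C',\mathcal D'$, let $H$ be a parity-check matrix of $\mathcal S'$,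 and let $F$ be such that $\binom HF$ is a generator matrix of $\mathcal S'$. Write $\mathrm{diag}(A,A)$ for the block diagonal matrix, $\mathcal C=\mathcal C'\times\mathcal C'$, $\mathcal D=\mathcal D'\times\mathcal D'$, $\mathcal S=\mathcal C\star\mathcal D$, $G_{\mathcal S}=\binom{\mathrm{diag}(H,H)}{\mathrm{diag}(F,F)}$, and let $V\subseteq\mathbb F_q^{2n}$ be the span of the $2c$ rows of $\mathrm{diag}(H,H)$. Columns of matrices of width $2n$ are indexed by pairs $(\pi,s)$, $\pi\in[2]$, $s\in[n]$. *Weyl operators and measurement.* On $(\mathbb C^q)^{\otimes n}$ with basis $|x\rangle$, $x\in\mathbb F_q^n$, let $\mathsf X(a)|x\rangle=|x+a\rangle$, $\mathsf Z(b)|x\rangle=\omega^{\mathrm{tr}(b\cdot x)}|x\rangle$, $\mathsf W(a,b)=\mathsf X(a)\mathsf Z(b)$. Put $\langle (a,b)|(a',b')\rangle_J=\mathrm{tr}(b\cdot a'-a\cdot b')$ and let $V^{\perp_J}$ be the corresponding dual of $V$. A stabilizer group of $V$ is an abelian subgroup $S$ of the group generated by all $\mathsf X(a),\mathsf Z(b)$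 that contains no scalar operator other than the identity and such that $V$ is the set of all $v$ for which some scalar multiple $\mathsf E(v)$ of $\mathsf W(v)$ is in $S$. For $\overline w\in\mathbb F_q^{2n}/V^{\perp_J}$ let $P_{\overline w}$ be the orthogonal projector onto $\{\psi:\mathsf E(v)\psi=\omega^{\langle v|w\rangle_J}\psi\ \ \forall v\in V\}$, and $\mathcal B^V=\{P_{\overline w}\}$. *Scheme.* The $m$ files are $X^i\in\mathbb F_q^{\beta\times 2k}$, $i\in[m]$, stacked to $X\in\mathbb F_q^{m\beta\times 2k}$ with rows indexed by $(i,b)$, $i\in[m]$, $b\in[\beta]$; server $s$ stores the columns $Y_{1,s},Y_{2,s}$ of $Y=X\,\mathrm{diag}(G_{\mathcal C'},G_{\mathcal C'})$. Let $g=c/\beta$. For $r\in[\rho]$, $b\in[\beta]$ let $\mathcal J_r^b\subseteq\{1,\dots,\max(c,k)\}$ be the set of the $g$ residues $(b+r-2)g+1,\dots,(b+r-2)g+g$ modulo $\max(c,k)$, and let $M^{(r)}=\mathrm{diag}(N^{(r)},N^{(r)})$, where $N^{(r)}$ has as rows the unit vectors $e_a\in\mathbb F_q^n$ for $b\in[\beta]$,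 $a\in\mathcal J_r^b$. The user desires file $K\in[m]$. In each round $r\in[\rho]$: 1. The state is initialized as $|\overline 0\rangle\langle\overline 0|\otimes\sigma_{\rm mix}=q^{\,n-2(k+t-1)}P_{\overline 0}$, and server $s$ receives the $s$-th system. 2. With $Z^{(r)}\in\mathbb F_q^{m\beta\times 2t}$ chosen uniformly at random, the user sends to server $s$ the columns $(1,s)$ and $(2,s)$ of $Q^{(r)}=Z^{(r)}\mathrm{diag}(G_{\mathcal D'},G_{\mathcal D'})+E_{(K)}M^{(r)}$, where the column of $E_{(K)}$ that belongs to $\pi\in[2]$ and $a\in\mathcal J_r^b$ is the unit vector with $1$ in position $(K,b)$. 3. Server $s$ computes $A^{(r)}_{\pi,s}=Y_{\pi,s}^\top Q^{(r)}_{\pi,s}$, $\pi\in[2]$, applies $\mathsf X(A^{(r)}_{1,s})\mathsf Z(A^{(r)}_{2,s})$ to its system and sends it to the user. 4. The user measures with $\mathcal B^V$; the output is the $o\in\mathbb F_q^{2c}$ for which the measured coset is that of $oM^{(r)}$. After $\rho$ rounds, with outputs $o^{(1)},\dots,o^{(\rho)}$, the user solves for $x\in\mathbb F_q^{\beta\times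 2k}$ the linear system stating that for all $r$, $\pi$, $b$ and $a\in\mathcal J_r^b$ the entry of $x\,\mathrm{diag}(G_{\mathcal C'},G_{\mathcal C'})$ in row $b$ and column $(\pi,a)$ equals the entry of $o^{(r)}$ at $(\pi,b,a)$. **Lemma (correctness).** The user recovers the desired file without error. In detail: (i) $V\subseteq V^{\perp_J}$; the rows of $G_{\mathcal S}$ are a basis of $V^{\perp_J}$, and $V^{\perp_J}=\mathcal S$. For every $r\in[\rho]$, $N^{(r)}$ has $c$ rows and $o\mapsto oM^{(r)}+V^{\perp_J}$ is a bijection $\mathbb F_q^{2c}\to\mathbb F_q^{2n}/V^{\perp_J}$. A stabilizer group of $V$ exists, and for each of them $\mathcal B^V$ is a projection-valued measurement and the initial state is a density operator. (ii) For all $m$, $K$, $X$, $r$, $Z^{(r)}$ the response vector satisfies $$A^{(r)}\in V^{\perp_J}+\big(Y^{K,b}_{1,a}\,\big|\,Y^{K,b}_{2,a}\big)_{b\in[\beta],\,a\in\mathcal J_r^b}\cdot M^{(r)}.$$ (iii) For every stabilizer group of $V$ and all $m$, $K$, $X$, $Z^{(1)},\dots,Z^{(\rho)}$, the output in round $r$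 is $\big(Y^{K,b}_{1,a}\,|\,Y^{K,b}_{2,a}\big)_{b,\,a\in\mathcal J_r^b}$ with probability $1$ (and every other output has probability $0$). With these outputs, the linear system has $X^K$ as its only solution, and hence with probability $1$, over the measurements of all $\rho$ rounds, the user obtains $X^K$. -/

import Mathlib

open scoped Matrix ComplexOrder

noncomputable section

namespace CodedQPIR

/-! ### Linear codes -/

section Codes

variable {F : Type*} [Field F]

/-- `C` is an `[n, k]` generalized Reed-Solomon code: for some pairwise distinct locators `α s` and
nonzero column multipliers `v s`, it consists of the vectors `(v s * f (α s))` with `deg f < k`. -/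
def IsGRS {n : ℕ} (k : ℕ) (C : Submodule F (Fin n → F)) : Prop :=
  k ≤ n ∧ ∃ (α v : Fin n → F), Function.Injective α ∧ (∀ s, v s ≠ 0) ∧
    ∀ x : Fin n → F, x ∈ C ↔
      ∃ f : Polynomial F, f.degree < (k : WithBot ℕ) ∧ ∀ s, x s = v s * f.eval (α s)

/-- The star product of two codes: the span of all componentwise products. -/
def starProd {ι : Type*} (C D : Submodule F (ι → F)) : Submodule F (ι → F) :=
  Submodule.span F {z | ∃ x ∈ C, ∃ y ∈ D, z = fun i => x i * y i}

/-- The (Euclidean) dual code. -/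
def dualCode {ι : Type*} [Fintype ι] (C : Submodule F (ι → F)) : Submodule F (ι → F) where
  carrier := {y | ∀ x ∈ C, x ⬝ᵥ y = 0}
  zero_mem' := fun x _ => dotProduct_zero x
  add_mem' := fun {a b} ha hb x hx => by rw [dotProduct_add, ha x hx, hb x hx, add_zero]
  smul_mem' := fun c y hy x hx => by rw [dotProduct_smul, hy x hx, smul_zero]

/-- A code is weakly self-dual if it contains its dual. -/
def WeaklySelfDual {ι : Type*} [Fintype ι] (C : Submodule F (ι → F)) : Prop :=
  dualCode C ≤ C

/-- The rows of `G` form a basis of `C`. -/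
def IsGeneratorMatrix {κ ι : Type*} (G : Matrix κ ι F) (C : Submodule F (ι → F)) : Prop :=
  LinearIndependent F G.row ∧ Submodule.span F (Set.range G.row) = C

/-- A parity-check matrix of `C` is a generator matrix of the dual code. -/
def IsParityCheckMatrix {κ ι : Type*} [Fintype ι] (H : Matrix κ ι F)
    (C : Submodule F (ι → F)) : Prop :=
  IsGeneratorMatrix H (dualCode C)

/-- The code `C × C`; position `(p, s)` is the `s`-th position of the `p`-th copy. -/
def codeProd {ι : Type*} (C : Submodule F (ι → F)) : Submodule F (Fin 2 × ι → F) where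
  carrier := {x | ∀ p, (fun s => x (p, s)) ∈ C}
  zero_mem' := fun _ => C.zero_mem
  add_mem' := fun ha hb p => C.add_mem (ha p) (hb p)
  smul_mem' := fun c _ hx p => C.smul_mem c (hx p)

/-- The block matrix `diag (A, A)`. -/
def diagTwo {μ ν : Type*} (A : Matrix μ ν F) : Matrix (Fin 2 × μ) (Fin 2 × ν) F :=
  Matrix.of fun i j => if i.1 = j.1 then A i.2 j.2 else 0

end Codes

/-! ### Weyl operators, stabilizer groups and their measurements

The space `H^{⊗n}`, with `H = ℂ^q`, has the orthonormal basis `|x⟩` for `x ∈ F^n`. Operators on it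
are matrices indexed by `Fin n → F`. -/

section Quantum

variable {F : Type*} [Field F] [Fintype F] [DecidableEq F]

/-- `X(a)|x⟩ = |x + a⟩` on one system. -/
def shiftOp (a : F) : Matrix F F ℂ := Matrix.of fun y x => if y = x + a then 1 else 0

/-- `Z(b)|x⟩ = ω ^ tr (b x) |x⟩` on one system, where `ω = exp (2πi/p)` and `tr : F → 𝔽_p` is the
field trace; `ZMod.stdAddChar j` is `ω ^ j`. -/
def clockOp (p : ℕ) [Fact p.Prime] [Algebra (ZMod p) F] (b : F) : Matrix F F ℂ :=
  Matrix.diagonal fun x => ZMod.stdAddChar (Algebra.trace (ZMod p) F (b * x))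

/-- The operator `A 1 ⊗ ... ⊗ A n` on `H^{⊗n}`. -/
def tensorOp {n : ℕ} (A : Fin n → Matrix F F ℂ) : Matrix (Fin n → F) (Fin n → F) ℂ :=
  Matrix.of fun x y => ∏ s, A s (x s) (y s)

/-- `X(a) = X(a 1) ⊗ ... ⊗ X(a n)`. -/
def shiftN {n : ℕ} (a : Fin n → F) : Matrix (Fin n → F) (Fin n → F) ℂ :=
  tensorOp fun s => shiftOp (a s)

/-- `Z(b) = Z(b 1) ⊗ ... ⊗ Z(b n)`. -/
def clockN (p : ℕ) [Fact p.Prime] [Algebra (ZMod p) F] {n : ℕ} (b : Fin n → F) :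
    Matrix (Fin n → F) (Fin n → F) ℂ :=
  tensorOp fun s => clockOp p (b s)

/-- The Weyl operator `W(a, b) = X(a) Z(b)`; a vector `v ∈ F^{2n}` is the pair
`a = v (0, ·)`, `b = v (1, ·)`. -/
def weyl (p : ℕ) [Fact p.Prime] [Algebra (ZMod p) F] {n : ℕ} (v : Fin 2 × Fin n → F) :
    Matrix (Fin n → F) (Fin n → F) ℂ :=
  shiftN (fun s => v (0, s)) * clockN p (fun s => v (1, s))

/-- The Heisenberg-Weyl group: the subgroup of the unitary group generated by all `X(a)`, `Z(b)`. -/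
def heisenbergWeyl (F : Type*) [Field F] [Fintype F] [DecidableEq F]
    (p : ℕ) [Fact p.Prime] [Algebra (ZMod p) F] (n : ℕ) :
    Subgroup (Matrix.unitaryGroup (Fin n → F) ℂ) :=
  Subgroup.closure {u | (∃ a : Fin n → F, (u : Matrix (Fin n → F) (Fin n → F) ℂ) = shiftN a) ∨
    ∃ b : Fin n → F, (u : Matrix (Fin n → F) (Fin n → F) ℂ) = clockN p b}

/-- A stabilizer group: an abelian subgroup of the Heisenberg-Weyl group that contains no scalar
operator except the identity. -/
def IsStabilizerGroup (p : ℕ) [Fact p.Prime] [Algebra (ZMod p) F] {n : ℕ}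
    (S : Subgroup (Matrix.unitaryGroup (Fin n → F) ℂ)) : Prop :=
  S ≤ heisenbergWeyl F p n ∧ (∀ g ∈ S, ∀ h ∈ S, g * h = h * g) ∧
    ∀ g ∈ S, ∀ z : ℂ, (g : Matrix (Fin n → F) (Fin n → F) ℂ) = z • 1 → z = 1

/-- The stabilizer group `S` belongs to the subspace `V`, i.e. `S = S(V)`: the vectors of `V` are
exactly those `v` for which some scalar multiple of `W(v)` is in `S`. -/
def IsStabilizerOf (p : ℕ) [Fact p.Prime] [Algebra (ZMod p) F] {n : ℕ}
    (S : Subgroup (Matrix.unitaryGroup (Fin n → F) ℂ))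
    (V : Submodule F (Fin 2 × Fin n → F)) : Prop :=
  IsStabilizerGroup p S ∧ ∀ v, v ∈ V ↔
    ∃ g ∈ S, ∃ z : ℂ, (g : Matrix (Fin n → F) (Fin n → F) ℂ) = z • weyl p v

/-- The matrix `J = (0, -I; I, 0)` of size `2n`. -/
def sympJ (F : Type*) [Field F] (n : ℕ) : Matrix (Fin 2 × Fin n) (Fin 2 × Fin n) F :=
  Matrix.of fun x y =>
    if x.2 = y.2 then
      if x.1 = 0 ∧ y.1 = 1 then -1 else if x.1 = 1 ∧ y.1 = 0 then 1 else 0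
    else 0

/-- The trace-symplectic product `⟨v | w⟩_J = tr (v J wᵀ)`. -/
def symp (p : ℕ) [Fact p.Prime] [Algebra (ZMod p) F] {n : ℕ} (v w : Fin 2 × Fin n → F) : ZMod p :=
  Algebra.trace (ZMod p) F (v ⬝ᵥ (sympJ F n *ᵥ w))

/-- The dual `V^{⊥_J}` with respect to the trace-symplectic product. -/
def sympDual (p : ℕ) [Fact p.Prime] [Algebra (ZMod p) F] {n : ℕ}
    (V : Submodule F (Fin 2 × Fin n → F)) : Submodule F (Fin 2 × Fin n → F) where
  carrier := {w | ∀ v ∈ V, symp p v w = 0}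
  zero_mem' := fun v _ => by simp [symp]
  add_mem' := fun {a b} ha hb v hv => by
    have h1 := ha v hv
    have h2 := hb v hv
    simp only [symp] at h1 h2 ⊢
    rw [Matrix.mulVec_add, dotProduct_add, map_add, h1, h2, add_zero]
  smul_mem' := fun c w hw v hv => by
    have h := hw (c • v) (V.smul_mem c hv)
    simp only [symp] at h ⊢
    rw [Matrix.mulVec_smul, dotProduct_smul, ← smul_dotProduct, h]

/-- The common eigenspace `H_w` of the stabilizer `S = S(V)` labelled by a coset
`w ∈ F^{2n} / V^{⊥_J}`: the element of `S` proportional to `W(v)` acts on it as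
`ω ^ ⟨v | w⟩_J`. -/
def stabEigenspace (p : ℕ) [Fact p.Prime] [Algebra (ZMod p) F] {n : ℕ}
    (S : Subgroup (Matrix.unitaryGroup (Fin n → F) ℂ)) (V : Submodule F (Fin 2 × Fin n → F))
    (w : (Fin 2 × Fin n → F) ⧸ sympDual p V) :
    Submodule ℂ (EuclideanSpace ℂ (Fin n → F)) where
  carrier := {ψ | ∀ v ∈ V, ∀ g ∈ S,
    (∃ z : ℂ, (g : Matrix (Fin n → F) (Fin n → F) ℂ) = z • weyl p v) →
    ∀ u, (sympDual p V).mkQ u = w →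
      Matrix.toEuclideanCLM (n := Fin n → F) (𝕜 := ℂ) g ψ =
        (ZMod.stdAddChar (symp p v u) : ℂ) • ψ}
  zero_mem' := fun v _ g _ _ u _ => by simp
  add_mem' := fun {a b} ha hb v hv g hg hz u hu => by
    rw [map_add, ha v hv g hg hz u hu, hb v hv g hg hz u hu, smul_add]
  smul_mem' := fun c ψ hψ v hv g hg hz u hu => by
    rw [map_smul, hψ v hv g hg hz u hu, smul_comm]

/-- The orthogonal projector `P_w` onto `H_w`; the family of all `P_w` is `B^V`. -/
def stabProj (p : ℕ) [Fact p.Prime] [Algebra (ZMod p) F] {n : ℕ}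
    (S : Subgroup (Matrix.unitaryGroup (Fin n → F) ℂ)) (V : Submodule F (Fin 2 × Fin n → F))
    (w : (Fin 2 × Fin n → F) ⧸ sympDual p V) : Matrix (Fin n → F) (Fin n → F) ℂ :=
  (Matrix.toEuclideanCLM (n := Fin n → F) (𝕜 := ℂ)).symm
    (stabEigenspace p S V w).starProjection

/-- A projection-valued measurement: pairwise orthogonal projectors with sum the identity. -/
def IsPVM {ι X : Type*} [Finite ι] [Fintype X] [DecidableEq X] (P : ι → Matrix X X ℂ) : Prop :=
  (∀ i, (P i).IsHermitian ∧ P i * P i = P i) ∧ (∀ i j, i ≠ j → P i * P j = 0) ∧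
    ∑ᶠ i, P i = 1

/-- A density operator. -/
def IsDensity {X : Type*} [Fintype X] (σ : Matrix X X ℂ) : Prop :=
  σ.PosSemidef ∧ σ.trace = 1

end Quantum

/-! ### The scheme

Rows of the storage matrix are indexed by `(i, b)` (file, block), columns of `2n`-wide matrices by
`(p, s)` (copy, server). All indices start at `0`. -/

section Scheme

/-- `c = n - k - t + 1`, i.e. `d - 1` for `d = n - k - t + 2` the minimum distance of the
`[n, k + t - 1]` star product code. -/
abbrev cPar (n k t : ℕ) : ℕ := n - k - t + 1

/-- `β = lcm (c, k) / k`. -/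
abbrev blocks (n k t : ℕ) : ℕ := Nat.lcm (cPar n k t) k / k

/-- `ρ = lcm (c, k) / c`. -/
abbrev rounds (n k t : ℕ) : ℕ := Nat.lcm (cPar n k t) k / cPar n k t

/-- The set `J_r^b` of servers from which symbols of block `b` are obtained in round `r`. In round
`0`, the first `β` consecutive intervals of length `c / β` of `{0, ..., max (c, k) - 1}` are used
for the blocks `b = 0, ..., β - 1`; each further round shifts all of them by `c / β`, cyclically. -/
def targets (n k t : ℕ) (r : Fin (rounds n k t)) (b : Fin (blocks n k t)) : Finset (Fin n) :=
  Finset.univ.filter fun s => ∃ j < cPar n k t / blocks n k t,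
    s.val = ((b.val + r.val) * (cPar n k t / blocks n k t) + j) % max (cPar n k t) k

/-- The pairs `(b, a)` with `a ∈ J_r^b`; there are `c` of them. -/
abbrev TIdx (n k t : ℕ) (r : Fin (rounds n k t)) : Type :=
  Σ b : Fin (blocks n k t), {a : Fin n // a ∈ targets n k t r b}

variable {F : Type*} [Field F] {n k t m : ℕ}

/-- `N^{(r)}`, whose rows are the unit vectors of the targeted servers. -/
def targetN (F : Type*) [Field F] (n k t : ℕ) (r : Fin (rounds n k t)) :
    Matrix (TIdx n k t r) (Fin n) F :=
  Matrix.of fun a s => if a.2.1 = s then 1 else 0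

/-- `M^{(r)} = diag (N^{(r)}, N^{(r)})`. -/
def targetM (F : Type*) [Field F] (n k t : ℕ) (r : Fin (rounds n k t)) :
    Matrix (Fin 2 × TIdx n k t r) (Fin 2 × Fin n) F :=
  diagTwo (targetN F n k t r)

/-- The encoded files `Y = X · diag (G, G)`. -/
def stored (GC : Matrix (Fin k) (Fin n) F)
    (X : Matrix (Fin m × Fin (blocks n k t)) (Fin 2 × Fin k) F) :
    Matrix (Fin m × Fin (blocks n k t)) (Fin 2 × Fin n) F :=
  X * diagTwo GC

/-- The matrix `E_(K)`: the column belonging to copy `p` and target `a ∈ J_r^b` is the unit vector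
of row `(K, b)`. -/
def selectE (F : Type*) [Field F] {n k t m : ℕ} (K : Fin m) (r : Fin (rounds n k t)) :
    Matrix (Fin m × Fin (blocks n k t)) (Fin 2 × TIdx n k t r) F :=
  Matrix.of fun ib pa => if ib = (K, pa.2.1) then 1 else 0

/-- The queries `Q^{(r)} = Z · diag (G_D, G_D) + E_(K) · M^{(r)}`; server `s` is sent the columns
`(0, s)` and `(1, s)`. -/
def query (GD : Matrix (Fin t) (Fin n) F) (K : Fin m) (r : Fin (rounds n k t))
    (Z : Matrix (Fin m × Fin (blocks n k t)) (Fin 2 × Fin t) F) :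
    Matrix (Fin m × Fin (blocks n k t)) (Fin 2 × Fin n) F :=
  Z * diagTwo GD + selectE F K r * targetM F n k t r

/-- The classical response symbols: dot products of corresponding columns of stored symbols and
queries. -/
def response (GC : Matrix (Fin k) (Fin n) F) (GD : Matrix (Fin t) (Fin n) F)
    (X : Matrix (Fin m × Fin (blocks n k t)) (Fin 2 × Fin k) F) (K : Fin m)
    (r : Fin (rounds n k t)) (Z : Matrix (Fin m × Fin (blocks n k t)) (Fin 2 × Fin t) F) :
    Fin 2 × Fin n → F :=
  fun ps => (fun ib => stored GC X ib ps) ⬝ᵥ (fun ib => query GD K r Z ib ps)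

/-- The desired symbols `Y_{p,a}^{K,b}`, `a ∈ J_r^b`, of round `r`. -/
def desired (GC : Matrix (Fin k) (Fin n) F)
    (X : Matrix (Fin m × Fin (blocks n k t)) (Fin 2 × Fin k) F) (K : Fin m)
    (r : Fin (rounds n k t)) : Fin 2 × TIdx n k t r → F :=
  fun pa => stored GC X (K, pa.2.1) (pa.1, pa.2.2.1)

/-- The file `X^K`. -/
def file (X : Matrix (Fin m × Fin (blocks n k t)) (Fin 2 × Fin k) F) (K : Fin m) :
    Matrix (Fin (blocks n k t)) (Fin 2 × Fin k) F :=
  Matrix.of fun b pκ => X (K, b) pκ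

/-- The linear system for a candidate file `x` given the outputs of all rounds: the encoding of `x`
has to agree with every retrieved symbol. -/
def SolvesSystem (GC : Matrix (Fin k) (Fin n) F)
    (o : ∀ r : Fin (rounds n k t), Fin 2 × TIdx n k t r → F)
    (x : Matrix (Fin (blocks n k t)) (Fin 2 × Fin k) F) : Prop :=
  ∀ (r : Fin (rounds n k t)) (pa : Fin 2 × TIdx n k t r),
    (x * diagTwo GC) pa.2.1 (pa.1, pa.2.2.1) = o r pa

/-- The generator matrix `(diag (H, H); diag (F', F'))` of the star product code. -/
def starGen {a b : ℕ} (H : Matrix (Fin a) (Fin n) F) (F' : Matrix (Fin b) (Fin n) F) :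
    Matrix ((Fin 2 × Fin a) ⊕ (Fin 2 × Fin b)) (Fin 2 × Fin n) F :=
  Matrix.fromRows (diagTwo H) (diagTwo F')

/-- The space `V` spanned by the upper rows `diag (H, H)` of the generator matrix. -/
def spaceV {a b : ℕ} (H : Matrix (Fin a) (Fin n) F) (F' : Matrix (Fin b) (Fin n) F) :
    Submodule F (Fin 2 × Fin n → F) :=
  Submodule.span F (Set.range fun i => (starGen H F').row (Sum.inl i))

variable [Fintype F] [DecidableEq F] (p : ℕ) [Fact p.Prime] [Algebra (ZMod p) F]

/-- The initial state `|0⟩⟨0| ⊗ σ_mix`, with `σ_mix = q^{n - 2(k+t-1)} · I`. In the decomposition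
`H^{⊗n} = 𝒲 ⊗ ℂ^{q^{2(k+t-1)-n}}` the subspace `|w⟩ ⊗ ℂ^{q^{2(k+t-1)-n}}` is `H_w`, so that
`|0⟩⟨0| ⊗ I` is the projector `P_0`. -/
def initialState (n k t : ℕ) (S : Subgroup (Matrix.unitaryGroup (Fin n → F) ℂ))
    (V : Submodule F (Fin 2 × Fin n → F)) : Matrix (Fin n → F) (Fin n → F) ℂ :=
  ((Fintype.card F : ℂ) ^ ((n : ℤ) - 2 * ((k : ℤ) + t - 1))) • stabProj p S V 0

/-- Server `s` applies `X(A (0, s)) Z(A (1, s))` to its own system. -/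
def serversOp (A : Fin 2 × Fin n → F) : Matrix (Fin n → F) (Fin n → F) ℂ :=
  tensorOp fun s => shiftOp (A (0, s)) * clockOp p (A (1, s))

/-- The state that the user receives, when the servers hold the response symbols `A`. -/
def receivedState (k t : ℕ) (S : Subgroup (Matrix.unitaryGroup (Fin n → F) ℂ))
    (V : Submodule F (Fin 2 × Fin n → F)) (A : Fin 2 × Fin n → F) :
    Matrix (Fin n → F) (Fin n → F) ℂ :=
  serversOp p A * initialState p n k t S V * (serversOp p A)ᴴ

/-- The probability (Born rule) that measuring the received state with `B^V` gives the output
`o ∈ F^{2c}`, i.e. the coset of `o · M^{(r)}`. -/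
def outputProb (S : Subgroup (Matrix.unitaryGroup (Fin n → F) ℂ))
    (V : Submodule F (Fin 2 × Fin n → F)) (A : Fin 2 × Fin n → F) (r : Fin (rounds n k t))
    (o : Fin 2 × TIdx n k t r → F) : ℝ :=
  (Matrix.trace (stabProj p S V ((sympDual p V).mkQ (o ᵥ* targetM F n k t r)) *
    receivedState p k t S V A)).re

open Classical in
/-- The probability, over the measurements of all `ρ` rounds (each on a fresh composite system), that
the file `X^K` is the unique solution of the linear system given by the outputs. -/
def successProb (GC : Matrix (Fin k) (Fin n) F) (GD : Matrix (Fin t) (Fin n) F)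
    (S : Subgroup (Matrix.unitaryGroup (Fin n → F) ℂ)) (V : Submodule F (Fin 2 × Fin n → F))
    (X : Matrix (Fin m × Fin (blocks n k t)) (Fin 2 × Fin k) F) (K : Fin m)
    (Z : Fin (rounds n k t) → Matrix (Fin m × Fin (blocks n k t)) (Fin 2 × Fin t) F) : ℝ :=
  ∑ o : (∀ r : Fin (rounds n k t), Fin 2 × TIdx n k t r → F),
    if ∀ x, SolvesSystem GC o x ↔ x = file X K then
      ∏ r, outputProb p S V (response GC GD X K r (Z r)) r (o r)
    else 0

end Scheme

end CodedQPIR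

end

/-! Conjugation by `W(A)` multiplies each `E(v)` by the phase `ω ^ (-⟨v | A⟩_J)`, hence carries
`P_w` to `P_(w + A)` (`WeylLift.weyl_conj_proj`). The servers' local operations amount to one global
`W(A)`, so the initial state, a multiple of `P_0`, becomes the same multiple of `P_A`, and the
measurement reveals exactly the coset of the response `A` modulo `V^{⊥_J}`. To make this computable,
`P_w` is identified with the character average `|V|⁻¹ ∑ ω ^ (-⟨v | w⟩_J) E(v)`
(`WeylLift.stabProj_eq`); products, sums and traces of projectors then reduce to orthogonality of
characters and to the vanishing trace of nontrivial Weyl operators.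

On the coding side, `V = S'^⊥ × S'^⊥` and `J` exchanges the two copies, so `V^{⊥_J} = S' × S' = C ⋆
D` (`sympDual_codeProd`, `starProd_codeProd`). The random part of a query is a codeword of `D`;
multiplied by stored codewords of `C` it contributes only an element of `V^{⊥_J}`, and the rest of
the response is the desired symbols times `M^{(r)}` (`response_eq`). No information is lost modulo
`V^{⊥_J}`: in each copy a word supported on the `c` targeted servers vanishes at `k + t - 1`
positions, so it is zero if it lies in `S'` (`eq_zero_of_vecMul_targetN_mem`).

With `g = gcd (c, k)`, one has `β g = c` and `ρ g = k`. Hence the targets are distinct within a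
round, and each block is read at `k` distinct servers over all rounds, which determines a codeword
of `C'` (`solvesSystem_desired_iff`). -/

open scoped Matrix ComplexOrder

set_option linter.unusedSectionVars false

noncomputable section

namespace CodedQPIR

/-! ### Weyl operators: phases, commutation, traces. -/

section Weyl

variable {F : Type*} [Field F] [Fintype F] [DecidableEq F]
variable (p : ℕ) [Fact p.Prime] [Algebra (ZMod p) F]

/-- The trace form over the prime field has no nonzero `F`-linear kernel. -/
theorem exists_trace_mul_ne_zero {a : F} (ha : a ≠ 0) :
    ∃ b : F, Algebra.trace (ZMod p) F (a * b) ≠ 0 := by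
  obtain ⟨c, hc⟩ := Algebra.trace_surjective (ZMod p) F 1
  refine ⟨a⁻¹ * c, ?_⟩
  rw [mul_inv_cancel_left₀ ha, hc]
  exact one_ne_zero

/-- The additive character `z ↦ ω ^ tr z` of `F`. -/
def traceChar : AddChar F ℂ :=
  (ZMod.stdAddChar (N := p)).compAddMonoidHom (Algebra.trace (ZMod p) F).toAddMonoidHom

theorem traceChar_apply (z : F) :
    traceChar p z = (ZMod.stdAddChar (Algebra.trace (ZMod p) F z) : ℂ) := rfl

theorem traceChar_sum {ι : Type*} (s : Finset ι) (f : ι → F) :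
    traceChar p (∑ i ∈ s, f i) = ∏ i ∈ s, traceChar p (f i) := by
  classical
  induction s using Finset.induction_on with
  | empty => simp
  | insert a s ha ih => rw [Finset.sum_insert ha, Finset.prod_insert ha, AddChar.map_add_eq_mul, ih]

variable {n : ℕ}

/-- The shift part `a` of `(a, b)`. -/
def fstPart (v : Fin 2 × Fin n → F) : Fin n → F := fun s => v (0, s)

/-- The clock part `b` of `(a, b)`. -/
def sndPart (v : Fin 2 × Fin n → F) : Fin n → F := fun s => v (1, s)

@[simp] theorem fstPart_add (v w : Fin 2 × Fin n → F) :
    fstPart (v + w) = fstPart v + fstPart w := rfl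
@[simp] theorem sndPart_add (v w : Fin 2 × Fin n → F) :
    sndPart (v + w) = sndPart v + sndPart w := rfl
@[simp] theorem fstPart_neg (v : Fin 2 × Fin n → F) : fstPart (-v) = -fstPart v := rfl
@[simp] theorem sndPart_neg (v : Fin 2 × Fin n → F) : sndPart (-v) = -sndPart v := rfl
@[simp] theorem fstPart_zero : fstPart (0 : Fin 2 × Fin n → F) = 0 := rfl
@[simp] theorem sndPart_zero : sndPart (0 : Fin 2 × Fin n → F) = 0 := rfl

theorem symp_eq (v w : Fin 2 × Fin n → F) :
    symp p v w = Algebra.trace (ZMod p) F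
      (sndPart v ⬝ᵥ fstPart w - fstPart v ⬝ᵥ sndPart w) := by
  unfold symp
  congr 1
  simp only [dotProduct, Matrix.mulVec, sympJ, Fintype.sum_prod_type, Fin.sum_univ_two,
    Matrix.of_apply, fstPart, sndPart]
  simp
  ring

theorem symp_add_left (u v w : Fin 2 × Fin n → F) :
    symp p (u + v) w = symp p u w + symp p v w := by
  simp only [symp, add_dotProduct, map_add]

theorem symp_add_right (u v w : Fin 2 × Fin n → F) :
    symp p u (v + w) = symp p u v + symp p u w := by
  simp only [symp, Matrix.mulVec_add, dotProduct_add, map_add]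

theorem symp_neg_left (v w : Fin 2 × Fin n → F) : symp p (-v) w = -symp p v w := by
  simp only [symp, neg_dotProduct, map_neg]

theorem symp_neg_right (v w : Fin 2 × Fin n → F) : symp p v (-w) = -symp p v w := by
  simp only [symp, Matrix.mulVec_neg, dotProduct_neg, map_neg]

theorem symp_zero_left (w : Fin 2 × Fin n → F) : symp p 0 w = 0 := by
  simp [symp]

/-- Nondegeneracy of the trace form on the whole space. A nonzero shift coordinate is detected by a
clock at the same position, and conversely. -/
theorem exists_symp_ne_zero {v : Fin 2 × Fin n → F} (hv : v ≠ 0) : ∃ w, symp p v w ≠ 0 := by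
  obtain ⟨⟨i, s⟩, hs⟩ := Function.ne_iff.mp hv
  obtain ⟨b, hb⟩ := exists_trace_mul_ne_zero p hs
  fin_cases i
  · refine ⟨fun x => if x = (1, s) then b else 0, ?_⟩
    rw [symp_eq]
    have h1 : fstPart (fun x : Fin 2 × Fin n => if x = (1, s) then b else 0) = 0 := by
      funext j; simp [fstPart]
    have h2 : sndPart (fun x : Fin 2 × Fin n => if x = (1, s) then b else 0) = Pi.single s b := by
      funext j; simp [sndPart, Pi.single_apply]
    rw [h1, h2, dotProduct_zero, dotProduct_single, zero_sub, map_neg, neg_ne_zero]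
    exact hb
  · refine ⟨fun x => if x = (0, s) then b else 0, ?_⟩
    rw [symp_eq]
    have h1 : sndPart (fun x : Fin 2 × Fin n => if x = (0, s) then b else 0) = 0 := by
      funext j; simp [sndPart]
    have h2 : fstPart (fun x : Fin 2 × Fin n => if x = (0, s) then b else 0) = Pi.single s b := by
      funext j; simp [fstPart, Pi.single_apply]
    rw [h1, h2, dotProduct_zero, dotProduct_single, sub_zero]
    exact hb

theorem stdAddChar_ne_one {z : ZMod p} (hz : z ≠ 0) : (ZMod.stdAddChar z : ℂ) ≠ 1 := by
  intro h
  rw [← AddChar.map_zero_eq_one (ZMod.stdAddChar (N := p))] at h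
  exact hz (ZMod.injective_stdAddChar h)

theorem shiftN_apply (a x y : Fin n → F) : shiftN a x y = if x = y + a then 1 else 0 := by
  simp only [shiftN, tensorOp, shiftOp, Matrix.of_apply, Finset.prod_ite_zero, funext_iff,
    Pi.add_apply, Finset.mem_univ, true_implies, Finset.prod_const_one]

theorem clockN_eq (b : Fin n → F) :
    clockN p b = Matrix.diagonal fun x => traceChar p (b ⬝ᵥ x) := by
  ext x y
  by_cases h : x = y
  · subst h
    rw [Matrix.diagonal_apply_eq, dotProduct, traceChar_sum]
    simp [clockN, tensorOp, clockOp, traceChar_apply]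
  · obtain ⟨s, hs⟩ := Function.ne_iff.mp h
    rw [Matrix.diagonal_apply_ne _ h]
    simp only [clockN, tensorOp, Matrix.of_apply]
    exact Finset.prod_eq_zero (Finset.mem_univ s) (Matrix.diagonal_apply_ne _ hs)

theorem weyl_apply (v : Fin 2 × Fin n → F) (x y : Fin n → F) :
    weyl p v x y = if x = y + fstPart v then traceChar p (sndPart v ⬝ᵥ y) else 0 := by
  rw [weyl, clockN_eq, Matrix.mul_diagonal, shiftN_apply, ite_mul, one_mul, zero_mul]
  rfl

theorem weyl_zero : weyl p (0 : Fin 2 × Fin n → F) = 1 := by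
  ext x y
  simp [weyl_apply, Matrix.one_apply]

theorem weyl_mul (v w : Fin 2 × Fin n → F) :
    weyl p v * weyl p w = traceChar p (sndPart v ⬝ᵥ fstPart w) • weyl p (v + w) := by
  ext x y
  rw [Matrix.mul_apply, Finset.sum_eq_single (y + fstPart w)]
  -- `W(w)` sends `|y⟩` to a multiple of `|y + a'⟩`, so this is the only intermediate basis vector;
  -- moving `Z(b)` past `X(a')` produces the phase.
  · simp only [weyl_apply, Matrix.smul_apply, fstPart_add, sndPart_add, add_dotProduct,
      dotProduct_add, AddChar.map_add_eq_mul, smul_eq_mul, if_true, ← add_assoc,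
      add_right_comm y (fstPart w) (fstPart v)]
    split_ifs <;> ring
  · intro z _ hz
    rw [weyl_apply p w, if_neg hz, mul_zero]
  · simp

theorem weyl_conjTranspose (v : Fin 2 × Fin n → F) :
    (weyl p v)ᴴ = traceChar p (sndPart v ⬝ᵥ fstPart v) • weyl p (-v) := by
  ext x y
  rw [Matrix.conjTranspose_apply, weyl_apply, Matrix.smul_apply, weyl_apply]
  by_cases h : y = x + fstPart v
  · have h' : x = y + fstPart (-v) := by rw [h, fstPart_neg]; abel
    rw [if_pos h, if_pos h', smul_eq_mul, ← AddChar.map_add_eq_mul]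
    change (starRingEnd ℂ) _ = _
    rw [← AddChar.map_neg_eq_conj, h, sndPart_neg, neg_dotProduct, dotProduct_add]
    congr 1
    ring
  · have h' : ¬ x = y + fstPart (-v) := fun h' => h (by rw [h', fstPart_neg]; abel)
    rw [if_neg h, if_neg h', star_zero, smul_zero]

theorem weyl_mul_conjTranspose (v : Fin 2 × Fin n → F) : weyl p v * (weyl p v)ᴴ = 1 := by
  rw [weyl_conjTranspose, Matrix.mul_smul, weyl_mul, smul_smul, ← AddChar.map_add_eq_mul,
    add_neg_cancel, weyl_zero, fstPart_neg, dotProduct_neg, add_neg_cancel,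
    AddChar.map_zero_eq_one, one_smul]

theorem weyl_mem_unitaryGroup (v : Fin 2 × Fin n → F) :
    weyl p v ∈ Matrix.unitaryGroup (Fin n → F) ℂ :=
  Matrix.mem_unitaryGroup_iff.mpr (weyl_mul_conjTranspose p v)

theorem weyl_conjTranspose_mul (v : Fin 2 × Fin n → F) : (weyl p v)ᴴ * weyl p v = 1 :=
  Matrix.mem_unitaryGroup_iff'.mp (weyl_mem_unitaryGroup p v)

theorem weyl_comm (v w : Fin 2 × Fin n → F) :
    weyl p w * weyl p v = (ZMod.stdAddChar (-symp p v w) : ℂ) • (weyl p v * weyl p w) := by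
  rw [weyl_mul, weyl_mul, symp_eq, smul_smul, add_comm w v, ← map_neg, ← traceChar_apply,
    ← AddChar.map_add_eq_mul, dotProduct_comm (fstPart v)]
  congr 2
  ring

theorem weyl_conj (v w : Fin 2 × Fin n → F) :
    weyl p w * weyl p v * (weyl p w)ᴴ = (ZMod.stdAddChar (-symp p v w) : ℂ) • weyl p v := by
  rw [weyl_comm, Matrix.smul_mul, Matrix.mul_assoc, weyl_mul_conjTranspose, Matrix.mul_one]

/-- Conjugation by a `W(w)` with `⟨v | w⟩_J ≠ 0` preserves the trace but multiplies it by a phase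
other than `1`. -/
theorem trace_weyl {v : Fin 2 × Fin n → F} (hv : v ≠ 0) : (weyl p v).trace = 0 := by
  obtain ⟨w, hw⟩ := exists_symp_ne_zero p hv
  have h := congrArg Matrix.trace (weyl_conj p v w)
  rw [Matrix.trace_mul_comm, ← Matrix.mul_assoc, weyl_conjTranspose_mul, Matrix.one_mul,
    Matrix.trace_smul, smul_eq_mul] at h
  have h1 := stdAddChar_ne_one p (neg_ne_zero.mpr hw)
  by_contra h0
  exact h1 (mul_right_cancel₀ h0 (by rw [← h, one_mul]))

/-- Otherwise `W(v) W(w)ᴴ` would be a nonzero scalar matrix, yet also a multiple of the traceless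
`W(v - w)`. -/
theorem weyl_eq_smul {v w : Fin 2 × Fin n → F} {z : ℂ} (h : weyl p v = z • weyl p w) : v = w := by
  by_contra hne
  have h2 : weyl p v * (weyl p w)ᴴ = z • 1 := by
    rw [h, Matrix.smul_mul, weyl_mul_conjTranspose]
  have hz : z ≠ 0 := by
    rintro rfl
    have h3 := weyl_mul_conjTranspose p v
    rw [h, zero_smul, Matrix.zero_mul] at h3
    exact zero_ne_one h3
  rw [weyl_conjTranspose, Matrix.mul_smul, weyl_mul, smul_smul, ← sub_eq_add_neg] at h2
  have h3 := congrArg Matrix.trace h2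
  rw [Matrix.trace_smul, trace_weyl p (sub_ne_zero.mpr hne), smul_zero, Matrix.trace_smul,
    Matrix.trace_one] at h3
  have : (Fintype.card (Fin n → F) : ℂ) ≠ 0 := by exact_mod_cast Fintype.card_ne_zero
  exact (smul_ne_zero hz this) h3.symm

theorem tensorOp_mul (A B : Fin n → Matrix F F ℂ) :
    tensorOp A * tensorOp B = tensorOp fun s => A s * B s := by
  ext x y
  simp only [tensorOp, Matrix.mul_apply, Matrix.of_apply, ← Finset.prod_mul_distrib]
  rw [Finset.prod_univ_sum, Fintype.piFinset_univ]

/-- Separate operations of the servers act as a single Weyl operator labelled by the response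
vector. -/
theorem serversOp_eq_weyl (A : Fin 2 × Fin n → F) : serversOp p A = weyl p A := by
  rw [weyl, shiftN, clockN, tensorOp_mul, serversOp]

theorem weyl_mem_heisenbergWeyl (v : Fin 2 × Fin n → F) :
    (⟨weyl p v, weyl_mem_unitaryGroup p v⟩ : Matrix.unitaryGroup (Fin n → F) ℂ) ∈
      heisenbergWeyl F p n := by
  have key (w : Fin 2 × Fin n → F)
      (h : (∃ a : Fin n → F, weyl p w = shiftN a) ∨ ∃ b : Fin n → F, weyl p w = clockN p b) :
      (⟨weyl p w, weyl_mem_unitaryGroup p w⟩ : Matrix.unitaryGroup (Fin n → F) ℂ) ∈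
        heisenbergWeyl F p n := Subgroup.subset_closure h
  -- Split `v` into its pure shift and pure clock parts, whose Weyl operators are generators of the
  -- group.
  let a : Fin 2 × Fin n → F := fun x => if x.1 = 0 then v x else 0
  let b : Fin 2 × Fin n → F := fun x => if x.1 = 0 then 0 else v x
  have ha : weyl p a = shiftN (fun s => v (0, s)) := by
    have h1 : clockN p (0 : Fin n → F) = 1 := by
      rw [clockN_eq]; simp
    have h2 : weyl p a = shiftN (fun s => v (0, s)) * clockN p (0 : Fin n → F) := rfl
    rw [h2, h1, Matrix.mul_one]
  have hb : weyl p b = clockN p (fun s => v (1, s)) := by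
    have h1 : shiftN (0 : Fin n → F) = 1 := by
      ext x y; rw [shiftN_apply, add_zero, Matrix.one_apply]
    have h2 : weyl p b = shiftN (0 : Fin n → F) * clockN p (fun s => v (1, s)) := rfl
    rw [h2, h1, Matrix.one_mul]
  have h := mul_mem (key a (Or.inl ⟨_, ha⟩)) (key b (Or.inr ⟨_, hb⟩))
  convert h using 1
  apply Subtype.ext
  change weyl p v = weyl p a * weyl p b
  rw [ha, hb, weyl]

/-- If `b · a' = 0` for all `(a, b), (a', b')` in `V`, the Weyl operators of `V` themselves form a
stabilizer group of `V`. -/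
theorem exists_isStabilizerOf (V : Submodule F (Fin 2 × Fin n → F))
    (hV : ∀ v ∈ V, ∀ w ∈ V, sndPart v ⬝ᵥ fstPart w = 0) : ∃ S, IsStabilizerOf p S V := by
  have hmul : ∀ v ∈ V, ∀ w ∈ V, weyl p v * weyl p w = weyl p (v + w) := fun v hv w hw => by
    rw [weyl_mul, hV v hv w hw, AddChar.map_zero_eq_one, one_smul]
  let S : Subgroup (Matrix.unitaryGroup (Fin n → F) ℂ) :=
    { carrier := {g | ∃ v ∈ V, (g : Matrix (Fin n → F) (Fin n → F) ℂ) = weyl p v}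
      one_mem' := ⟨0, V.zero_mem, (weyl_zero p).symm⟩
      mul_mem' := by
        rintro g h ⟨v, hv, hg⟩ ⟨w, hw, hh⟩
        refine ⟨v + w, V.add_mem hv hw, ?_⟩
        rw [← hmul v hv w hw, ← hg, ← hh]
        rfl
      inv_mem' := by
        rintro g ⟨v, hv, hg⟩
        refine ⟨-v, V.neg_mem hv, ?_⟩
        change (g : Matrix (Fin n → F) (Fin n → F) ℂ)ᴴ = _
        rw [hg, weyl_conjTranspose, hV v hv v hv, AddChar.map_zero_eq_one, one_smul] }
  refine ⟨S, ⟨?_, ?_, ?_⟩, fun v => ⟨fun hv => ?_, ?_⟩⟩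
  · rintro g ⟨v, hv, hg⟩
    have : g = ⟨weyl p v, weyl_mem_unitaryGroup p v⟩ := Subtype.ext hg
    rw [this]
    exact weyl_mem_heisenbergWeyl p v
  · rintro g ⟨v, hv, hg⟩ h ⟨w, hw, hh⟩
    apply Subtype.ext
    change (g : Matrix (Fin n → F) (Fin n → F) ℂ) * h = (h : Matrix (Fin n → F) (Fin n → F) ℂ) * g
    rw [hg, hh, hmul v hv w hw, hmul w hw v hv, add_comm]
  · rintro g ⟨v, hv, hg⟩ z hz
    -- With the identity read as `W(0)`, proportionality forces `v = 0`, and then `z = 1` by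
    -- comparing one entry.
    rw [hg, ← weyl_zero p] at hz
    have h0 := weyl_eq_smul p hz
    subst h0
    rw [weyl_zero] at hz
    have h1 := congrFun (congrFun hz 0) 0
    simpa using h1.symm
  · exact ⟨⟨weyl p v, weyl_mem_unitaryGroup p v⟩, ⟨v, hv, rfl⟩, 1, (one_smul _ _).symm⟩
  · rintro ⟨g, ⟨w, hw, hg⟩, z, hz⟩
    rw [hg] at hz
    rwa [← weyl_eq_smul p hz]

end Weyl

/-! ### Stabilizer groups and their projectors as character averages. -/

section Stabilizer

variable {F : Type*} [Field F] [Fintype F] [DecidableEq F]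
variable (p : ℕ) [Fact p.Prime] [Algebra (ZMod p) F] {n : ℕ}

/-- A choice of phases turning the Weyl operators of `V` into a unitary representation of `V`. -/
structure WeylLift (V : Submodule F (Fin 2 × Fin n → F)) where
  /-- The operator `E(v)`. -/
  op : V → Matrix (Fin n → F) (Fin n → F) ℂ
  op_zero : op 0 = 1
  op_add : ∀ v w, op (v + w) = op v * op w
  op_conj : ∀ v, (op v)ᴴ = op (-v)
  op_weyl : ∀ v, ∃ z : ℂ, op v = z • weyl p (v : Fin 2 × Fin n → F)

variable {p} {V : Submodule F (Fin 2 × Fin n → F)}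

theorem symp_eq_of_mkQ_eq {v u w : Fin 2 × Fin n → F} (hv : v ∈ V)
    (h : (sympDual p V).mkQ u = (sympDual p V).mkQ w) : symp p v u = symp p v w := by
  have h1 : u - w ∈ sympDual p V := (Submodule.Quotient.eq _).mp h
  have h2 : symp p v (u - w) = 0 := h1 v hv
  rw [sub_eq_add_neg, symp_add_right, symp_neg_right] at h2
  linear_combination h2

/-- The quotient `g h⁻¹` is a scalar in `S`, hence the identity: `S` fixes exactly one phase for
each vector of `V`. -/
theorem IsStabilizerOf.eq_of_smul_weyl {S : Subgroup (Matrix.unitaryGroup (Fin n → F) ℂ)}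
    (hS : IsStabilizerOf p S V) {g h : Matrix.unitaryGroup (Fin n → F) ℂ} (hg : g ∈ S) (hh : h ∈ S)
    {v : Fin 2 × Fin n → F} {y z : ℂ}
    (hgy : (g : Matrix (Fin n → F) (Fin n → F) ℂ) = y • weyl p v)
    (hhz : (h : Matrix (Fin n → F) (Fin n → F) ℂ) = z • weyl p v) : g = h := by
  have h1 : ((g * h⁻¹ : Matrix.unitaryGroup (Fin n → F) ℂ) : Matrix (Fin n → F) (Fin n → F) ℂ) =
      (y * star z) • 1 := by
    change (g : Matrix (Fin n → F) (Fin n → F) ℂ) * (h : Matrix (Fin n → F) (Fin n → F) ℂ)ᴴ = _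
    rw [hgy, hhz, Matrix.conjTranspose_smul, Matrix.smul_mul, Matrix.mul_smul,
      weyl_mul_conjTranspose, smul_smul]
  have h2 := hS.1.2.2 _ (S.mul_mem hg (S.inv_mem hh)) _ h1
  rw [h2, one_smul] at h1
  exact mul_inv_eq_one.mp (Subtype.ext h1)

/-- A stabilizer group of `V` provides phases, and its labelled eigenspaces are the isotypic
components of the resulting representation. -/
theorem IsStabilizerOf.exists_weylLift {S : Subgroup (Matrix.unitaryGroup (Fin n → F) ℂ)}
    (hS : IsStabilizerOf p S V) : ∃ E : WeylLift p V, ∀ (w : Fin 2 × Fin n → F) ψ,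
      ψ ∈ stabEigenspace p S V ((sympDual p V).mkQ w) ↔
        ∀ v : V, Matrix.toEuclideanCLM (n := Fin n → F) (𝕜 := ℂ) (E.op v) ψ =
          (ZMod.stdAddChar (symp p (v : Fin 2 × Fin n → F) w) : ℂ) • ψ := by
  -- This choice is forced by uniqueness of phases. The representation laws follow: both sides lie
  -- in `S` and are proportional to the same Weyl operator.
  choose g hgS z hgz using fun v : V => (hS.2 v).mp v.2
  let E : WeylLift p V :=
    { op := fun v => (g v : Matrix (Fin n → F) (Fin n → F) ℂ)
      op_zero := by
        have h : g 0 = 1 := hS.eq_of_smul_weyl (hgS 0) S.one_mem (hgz 0)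
          (z := 1) (by rw [Submodule.coe_zero, weyl_zero, one_smul]; rfl)
        rw [h]; rfl
      op_add := fun v w => by
        have h : g (v + w) = g v * g w := by
          refine hS.eq_of_smul_weyl (hgS _) (S.mul_mem (hgS v) (hgS w)) (hgz _)
            (z := z v * (z w * traceChar p (sndPart (v : Fin 2 × Fin n → F) ⬝ᵥ
              fstPart (w : Fin 2 × Fin n → F)))) ?_
          change (g v : Matrix (Fin n → F) (Fin n → F) ℂ) * g w = _
          rw [hgz v, hgz w, Matrix.smul_mul, Matrix.mul_smul, weyl_mul, smul_smul, smul_smul, mul_assoc]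
          rfl
        rw [h]; rfl
      op_conj := fun v => by
        have h : g (-v) = (g v)⁻¹ := by
          refine hS.eq_of_smul_weyl (hgS _) (S.inv_mem (hgS v)) (hgz _)
            (z := star (z v) * traceChar p (sndPart (v : Fin 2 × Fin n → F) ⬝ᵥ
              fstPart (v : Fin 2 × Fin n → F))) ?_
          change (g v : Matrix (Fin n → F) (Fin n → F) ℂ)ᴴ = _
          rw [hgz v, Matrix.conjTranspose_smul, weyl_conjTranspose, smul_smul]
          rfl
        rw [h]; rfl
      op_weyl := fun v => ⟨z v, hgz v⟩ }
  refine ⟨E, fun w ψ => ⟨fun h v => h v v.2 (g v) (hgS v) ⟨z v, hgz v⟩ w rfl, ?_⟩⟩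
  rintro h v hv g' hg' ⟨y, hy⟩ u hu
  rw [symp_eq_of_mkQ_eq hv hu, hS.eq_of_smul_weyl hg' (hgS ⟨v, hv⟩) hy (hgz ⟨v, hv⟩)]
  exact h ⟨v, hv⟩

namespace WeylLift

variable (E : WeylLift p V)

/-- The character average `|V|⁻¹ ∑ ω ^ (-⟨v | w⟩_J) E(v)`. -/
def proj (w : Fin 2 × Fin n → F) : Matrix (Fin n → F) (Fin n → F) ℂ :=
  (Nat.card V : ℂ)⁻¹ • ∑ᶠ v : V,
    (ZMod.stdAddChar (-symp p (v : Fin 2 × Fin n → F) w) : ℂ) • E.op v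

theorem card_ne_zero (V : Submodule F (Fin 2 × Fin n → F)) : (Nat.card V : ℂ) ≠ 0 := by
  exact_mod_cast Nat.card_pos.ne'

theorem proj_eq [Fintype V] (w : Fin 2 × Fin n → F) :
    E.proj w = (Nat.card V : ℂ)⁻¹ • ∑ v : V,
      (ZMod.stdAddChar (-symp p (v : Fin 2 × Fin n → F) w) : ℂ) • E.op v := by
  rw [proj, finsum_eq_sum_of_fintype]

/-- Left multiplication by `E(v)` translates the summation index by `v`, which costs one character
value. -/
theorem op_mul_proj (v : V) (w : Fin 2 × Fin n → F) :
    E.op v * E.proj w = (ZMod.stdAddChar (symp p (v : Fin 2 × Fin n → F) w) : ℂ) • E.proj w := by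
  have := Fintype.ofFinite V
  rw [proj_eq, Matrix.mul_smul, smul_comm, Finset.mul_sum]
  congr 1
  rw [Finset.smul_sum]
  conv_rhs => rw [← Equiv.sum_comp (Equiv.addLeft v)]
  refine Finset.sum_congr rfl fun u _ => ?_
  rw [Matrix.mul_smul, ← E.op_add, smul_smul, ← AddChar.map_add_eq_mul,
    Equiv.coe_addLeft, Submodule.coe_add, symp_add_left]
  congr 3
  ring

-- By `op_mul_proj` the product is `E.proj w'` times the average over `V` of the character `v ↦ ω ^
-- ⟨v | w' - w⟩_J`. That average is `1` if the character is trivial on `V`, i.e. if the cosets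
-- agree, and `0` otherwise.
open Classical in
theorem proj_mul_proj (w w' : Fin 2 × Fin n → F) :
    E.proj w * E.proj w' =
      if (sympDual p V).mkQ w = (sympDual p V).mkQ w' then E.proj w' else 0 := by
  have := Fintype.ofFinite V
  have key : E.proj w * E.proj w' = ((Nat.card V : ℂ)⁻¹ * ∑ v : V,
      (ZMod.stdAddChar (symp p (v : Fin 2 × Fin n → F) (w' - w)) : ℂ)) • E.proj w' := by
    rw [proj_eq E w, Matrix.smul_mul, Finset.sum_mul, mul_smul, Finset.sum_smul]
    congr 1
    refine Finset.sum_congr rfl fun v _ => ?_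
    rw [Matrix.smul_mul, op_mul_proj, smul_smul, ← AddChar.map_add_eq_mul, sub_eq_add_neg,
      symp_add_right, symp_neg_right, add_comm]
  rw [key]
  split_ifs with h
  · have h1 : ∀ v : V, symp p (v : Fin 2 × Fin n → F) (w' - w) = 0 := fun v => by
      rw [sub_eq_add_neg, symp_add_right, symp_neg_right, symp_eq_of_mkQ_eq v.2 h, add_neg_cancel]
    simp only [h1, AddChar.map_zero_eq_one, Finset.sum_const, Finset.card_univ, nsmul_eq_mul,
      mul_one, Nat.card_eq_fintype_card]
    rw [inv_mul_cancel₀, one_smul]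
    rw [← Nat.card_eq_fintype_card]
    exact card_ne_zero V
  · have h1 : w' - w ∉ sympDual p V := fun h' => h ((Submodule.Quotient.eq _).mpr h').symm
    obtain ⟨v₀, hv₀, hne⟩ : ∃ v ∈ V, symp p v (w' - w) ≠ 0 := by
      by_contra! hcon
      exact h1 hcon
    have h2 : ∑ v : V, (ZMod.stdAddChar (symp p (v : Fin 2 × Fin n → F) (w' - w)) : ℂ) = 0 := by
      -- Translating by `v₀` multiplies the sum by a number other than `1` without changing it, so
      -- the sum vanishes.
      have h3 : (ZMod.stdAddChar (symp p v₀ (w' - w)) : ℂ) *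
          ∑ v : V, (ZMod.stdAddChar (symp p (v : Fin 2 × Fin n → F) (w' - w)) : ℂ) =
          ∑ v : V, (ZMod.stdAddChar (symp p (v : Fin 2 × Fin n → F) (w' - w)) : ℂ) := by
        rw [Finset.mul_sum]
        conv_rhs => rw [← Equiv.sum_comp (Equiv.addLeft (⟨v₀, hv₀⟩ : V))]
        refine Finset.sum_congr rfl fun v _ => ?_
        rw [Equiv.coe_addLeft, Submodule.coe_add, symp_add_left, AddChar.map_add_eq_mul]
      by_contra h0
      exact stdAddChar_ne_one p hne (mul_right_cancel₀ h0 (by rw [h3, one_mul]))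
    rw [h2, mul_zero, zero_smul]

theorem proj_mul_self (w : Fin 2 × Fin n → F) : E.proj w * E.proj w = E.proj w := by
  rw [proj_mul_proj, if_pos rfl]

theorem proj_isHermitian (w : Fin 2 × Fin n → F) : (E.proj w).IsHermitian := by
  have := Fintype.ofFinite V
  rw [Matrix.IsHermitian, proj_eq, Matrix.conjTranspose_smul, Matrix.conjTranspose_sum]
  congr 1
  · simp
  · rw [← Equiv.sum_comp (Equiv.neg V)]
    refine Finset.sum_congr rfl fun v _ => ?_
    rw [Matrix.conjTranspose_smul, op_conj, Equiv.neg_apply, neg_neg, Submodule.coe_neg,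
      symp_neg_left, neg_neg]
    congr 1
    change (starRingEnd ℂ) _ = _
    rw [← AddChar.map_neg_eq_conj]

theorem proj_posSemidef (w : Fin 2 × Fin n → F) : (E.proj w).PosSemidef := by
  have h := Matrix.posSemidef_conjTranspose_mul_self (E.proj w)
  rwa [E.proj_isHermitian w, proj_mul_self] at h

/-- Only `v = 0` contributes, every other Weyl operator being traceless. -/
theorem trace_proj (w : Fin 2 × Fin n → F) :
    (E.proj w).trace = (Nat.card V : ℂ)⁻¹ * (Fintype.card F : ℂ) ^ n := by
  have := Fintype.ofFinite V
  rw [proj_eq, Matrix.trace_smul, Matrix.trace_sum, Finset.sum_eq_single 0]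
  · rw [E.op_zero, Matrix.trace_smul, Matrix.trace_one, Submodule.coe_zero, symp_zero_left]
    simp
  · intro v _ hv
    obtain ⟨z, hz⟩ := E.op_weyl v
    rw [hz, Matrix.trace_smul, Matrix.trace_smul, trace_weyl p (by simpa using hv), smul_zero,
      smul_zero]
  · simp

/-- Each `E(v)` picks up `ω ^ (-⟨v | A⟩_J)`, precisely the change of coefficient from `w` to `w +
A`. -/
theorem weyl_conj_proj (A w : Fin 2 × Fin n → F) :
    weyl p A * E.proj w * (weyl p A)ᴴ = E.proj (w + A) := by
  have := Fintype.ofFinite V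
  rw [proj_eq, proj_eq, Matrix.mul_smul, Matrix.smul_mul, Finset.mul_sum, Finset.sum_mul]
  congr 1
  refine Finset.sum_congr rfl fun v _ => ?_
  obtain ⟨z, hz⟩ := E.op_weyl v
  rw [hz, symp_add_right, neg_add, AddChar.map_add_eq_mul, Matrix.mul_smul, Matrix.mul_smul,
    Matrix.smul_mul, Matrix.smul_mul, weyl_conj, smul_smul, smul_smul, smul_smul]
  congr 1
  ring

/-- After exchanging the sums, a nonzero `v` yields the sum of a nontrivial character of the
quotient, which is zero; `v = 0` yields the index of `V^{⊥_J}` over `|V|`, which `hcard` makes `1`.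
-/
theorem sum_proj (hcard : Nat.card ((Fin 2 × Fin n → F) ⧸ sympDual p V) = Nat.card V)
    [Fintype ((Fin 2 × Fin n → F) ⧸ sympDual p V)] :
    ∑ w : (Fin 2 × Fin n → F) ⧸ sympDual p V, E.proj w.out = 1 := by
  have := Fintype.ofFinite V
  simp only [proj_eq]
  rw [← Finset.smul_sum, Finset.sum_comm, Finset.sum_eq_single 0]
  · simp only [Submodule.coe_zero, symp_zero_left, neg_zero, AddChar.map_zero_eq_one, one_smul,
      E.op_zero, Finset.sum_const, Finset.card_univ]
    rw [← Nat.card_eq_fintype_card, hcard, ← Nat.cast_smul_eq_nsmul ℂ, smul_smul,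
      inv_mul_cancel₀ (card_ne_zero V), one_smul]
  · intro v _ hv
    rw [← Finset.sum_smul]
    obtain ⟨u, hu⟩ := exists_symp_ne_zero p (v := (v : Fin 2 × Fin n → F)) (by simpa using hv)
    have hmk (w : (Fin 2 × Fin n → F) ⧸ sympDual p V) : (sympDual p V).mkQ w.out = w :=
      Quotient.out_eq _
    have h3 : (ZMod.stdAddChar (-symp p (v : Fin 2 × Fin n → F) u) : ℂ) *
        ∑ w : (Fin 2 × Fin n → F) ⧸ sympDual p V,
          (ZMod.stdAddChar (-symp p (v : Fin 2 × Fin n → F) w.out) : ℂ) =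
        ∑ w : (Fin 2 × Fin n → F) ⧸ sympDual p V,
          (ZMod.stdAddChar (-symp p (v : Fin 2 × Fin n → F) w.out) : ℂ) := by
      rw [Finset.mul_sum]
      conv_rhs => rw [← Equiv.sum_comp (Equiv.addLeft ((sympDual p V).mkQ u))]
      refine Finset.sum_congr rfl fun w _ => ?_
      rw [← AddChar.map_add_eq_mul, ← neg_add, ← symp_add_right]
      congr 2
      -- Chosen representatives need not add up, but pairing with `v ∈ V` depends only on cosets.
      refine symp_eq_of_mkQ_eq v.2 ?_
      rw [map_add, hmk, hmk, Equiv.coe_addLeft]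
    have h0 : ∑ w : (Fin 2 × Fin n → F) ⧸ sympDual p V,
          (ZMod.stdAddChar (-symp p (v : Fin 2 × Fin n → F) w.out) : ℂ) = 0 := by
      by_contra h0
      exact stdAddChar_ne_one p (neg_ne_zero.mpr hu) (mul_right_cancel₀ h0 (by rw [h3, one_mul]))
    rw [h0, zero_smul]
  · simp

/-- The character average is the orthogonal projector onto the labelled eigenspace. -/
theorem stabProj_eq {S : Subgroup (Matrix.unitaryGroup (Fin n → F) ℂ)}
    (hE : ∀ (w : Fin 2 × Fin n → F) ψ, ψ ∈ stabEigenspace p S V ((sympDual p V).mkQ w) ↔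
      ∀ v : V, Matrix.toEuclideanCLM (n := Fin n → F) (𝕜 := ℂ) (E.op v) ψ =
        (ZMod.stdAddChar (symp p (v : Fin 2 × Fin n → F) w) : ℂ) • ψ)
    (w : Fin 2 × Fin n → F) : stabProj p S V ((sympDual p V).mkQ w) = E.proj w := by
  have := Fintype.ofFinite V
  set T := Matrix.toEuclideanCLM (n := Fin n → F) (𝕜 := ℂ) with hT
  -- A self-adjoint operator that maps into a subspace and fixes it pointwise is its orthogonal
  -- projector: `hmem`, `hfix` and `hadj` are these three facts.
  have hmem (ψ) : T (E.proj w) ψ ∈ stabEigenspace p S V ((sympDual p V).mkQ w) := by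
    rw [hE]
    intro v
    rw [← mul_apply_eq_comp, ← map_mul, op_mul_proj, map_smul]
    rfl
  have hfix (ψ) (hψ : ψ ∈ stabEigenspace p S V ((sympDual p V).mkQ w)) :
      T (E.proj w) ψ = ψ := by
    rw [hE] at hψ
    rw [proj_eq, map_smul, map_sum, smul_apply, sum_apply]
    have h1 (v : V) : T ((ZMod.stdAddChar (-symp p (v : Fin 2 × Fin n → F) w) : ℂ) • E.op v) ψ =
        ψ := by
      rw [map_smul, smul_apply, hψ v, smul_smul, ← AddChar.map_add_eq_mul,
        neg_add_cancel, AddChar.map_zero_eq_one, one_smul]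
    rw [Finset.sum_congr rfl fun v _ => h1 v, Finset.sum_const, Finset.card_univ,
      ← Nat.card_eq_fintype_card, ← Nat.cast_smul_eq_nsmul ℂ, smul_smul,
      inv_mul_cancel₀ (card_ne_zero V), one_smul]
  have hadj : ContinuousLinearMap.adjoint (T (E.proj w)) = T (E.proj w) := by
    rw [← ContinuousLinearMap.star_eq_adjoint, ← map_star, Matrix.star_eq_conjTranspose,
      E.proj_isHermitian w]
  rw [stabProj, StarAlgEquiv.symm_apply_eq]
  ext1 ψ
  refine Submodule.eq_starProjection_of_mem_orthogonal (hmem ψ) ?_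
  rw [Submodule.mem_orthogonal]
  intro u hu
  rw [← hfix u hu, ← hadj, ContinuousLinearMap.adjoint_inner_left, map_sub, hadj,
    ← mul_apply_eq_comp, ← map_mul, proj_mul_self, sub_self, inner_zero_right]

end WeylLift

end Stabilizer

/-! ### GRS codes, generator matrices, products and duals. -/

section CodeLemmas

variable {F : Type*} [Field F]

/-- `k` symbols of a codeword of a GRS code of dimension `k` determine it. -/
theorem IsGRS.eq_zero {n k : ℕ} {C : Submodule F (Fin n → F)} (hC : IsGRS k C) {x : Fin n → F}
    (hx : x ∈ C) (s : Finset (Fin n)) (hs : k ≤ s.card) (h0 : ∀ i ∈ s, x i = 0) : x = 0 := by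
  obtain ⟨-, α, v, hα, hv, hmem⟩ := hC
  obtain ⟨f, hf, hfx⟩ := (hmem x).mp hx
  have h1 : f = 0 := by
    refine Polynomial.eq_zero_of_degree_lt_of_eval_index_eq_zero s hα.injOn
      (hf.trans_le (by exact_mod_cast hs)) fun i hi => ?_
    have h2 := h0 i hi
    rw [hfx] at h2
    exact (mul_eq_zero.mp h2).resolve_left (hv i)
  funext i
  rw [hfx, h1, Polynomial.eval_zero, mul_zero, Pi.zero_apply]

section GeneratorMatrix

variable {κ ι : Type*} [Fintype κ]

theorem isGeneratorMatrix_iff {G : Matrix κ ι F} {C : Submodule F (ι → F)} :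
    IsGeneratorMatrix G C ↔ Function.Injective (fun c => c ᵥ* G) ∧
      ∀ x, x ∈ C ↔ ∃ c, c ᵥ* G = x := by
  have h1 : (Submodule.span F (Set.range G.row) = C) ↔ ∀ x, x ∈ C ↔ ∃ c, c ᵥ* G = x := by
    rw [← _root_.range_vecMulLinear, eq_comm, SetLike.ext_iff]
    rfl
  rw [IsGeneratorMatrix, h1]
  exact and_congr_left' Matrix.vecMul_injective_iff.symm

theorem IsGeneratorMatrix.finrank_eq {G : Matrix κ ι F} {C : Submodule F (ι → F)}
    (h : IsGeneratorMatrix G C) : Module.finrank F C = Fintype.card κ := by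
  rw [← h.2]
  exact finrank_span_eq_card h.1

theorem IsGeneratorMatrix.reindex {κ' : Type*} {G : Matrix κ ι F} {C : Submodule F (ι → F)}
    (h : IsGeneratorMatrix G C) (e : κ' ≃ κ) : IsGeneratorMatrix (G.submatrix e id) C := by
  refine ⟨h.1.comp e e.injective, ?_⟩
  rw [← h.2]
  congr 1
  exact e.surjective.range_comp G.row

theorem vecMul_diagTwo {ν : Type*} (A : Matrix κ ν F) (c : Fin 2 × κ → F) (i : Fin 2) (s : ν) :
    (c ᵥ* diagTwo A) (i, s) = ((fun a => c (i, a)) ᵥ* A) s := by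
  simp only [Matrix.vecMul, dotProduct, diagTwo, Matrix.of_apply, Fintype.sum_prod_type]
  rw [Finset.sum_eq_single i]
  · simp
  · intro j _ hj
    simp [hj]
  · simp

theorem IsGeneratorMatrix.diagTwo {G : Matrix κ ι F} {C : Submodule F (ι → F)}
    (h : IsGeneratorMatrix G C) : IsGeneratorMatrix (diagTwo G) (codeProd C) := by
  rw [isGeneratorMatrix_iff] at h ⊢
  refine ⟨fun c d hcd => ?_, fun x => ⟨fun hx => ?_, ?_⟩⟩
  · funext ⟨i, a⟩
    refine congrFun (h.1 (a₁ := fun a => c (i, a)) (a₂ := fun a => d (i, a)) ?_) a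
    funext s
    have := congrFun hcd (i, s)
    simpa only [vecMul_diagTwo] using this
  · choose c hc using fun i => (h.2 _).mp (hx i)
    refine ⟨fun ia => c ia.1 ia.2, ?_⟩
    funext ⟨i, s⟩
    rw [vecMul_diagTwo]
    exact congrFun (hc i) s
  · rintro ⟨c, rfl⟩ i
    rw [h.2]
    exact ⟨fun a => c (i, a), funext fun s => (vecMul_diagTwo G c i s).symm⟩

end GeneratorMatrix

/-- For the harder inclusion, padding a word with zeros in the other copy sends products to
products, and every word is the sum of its two padded halves. -/
theorem starProd_codeProd {ι : Type*} (C D : Submodule F (ι → F)) :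
    starProd (codeProd C) (codeProd D) = codeProd (starProd C D) := by
  apply le_antisymm
  · refine Submodule.span_le.mpr ?_
    rintro _ ⟨x, hx, y, hy, rfl⟩ i
    exact Submodule.subset_span ⟨_, hx i, _, hy i, rfl⟩
  · intro z hz
    have hemb (i : Fin 2) : starProd C D ≤ (starProd (codeProd C) (codeProd D)).comap
        (LinearMap.pi fun js : Fin 2 × ι => if js.1 = i then LinearMap.proj js.2 else 0) := by
      have aux (E : Submodule F (ι → F)) {x : ι → F} (hx : x ∈ E) :
          (fun js : Fin 2 × ι => if js.1 = i then x js.2 else 0) ∈ codeProd E := by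
        intro j
        by_cases hj : j = i
        · simpa [hj] using hx
        · simp only [if_neg hj]
          exact E.zero_mem
      refine Submodule.span_le.mpr ?_
      rintro _ ⟨x, hx, y, hy, rfl⟩
      refine Submodule.subset_span ⟨_, aux C hx, _, aux D hy, ?_⟩
      funext js
      by_cases hj : js.1 = i <;> simp [hj]
    have hsum : z = ∑ i : Fin 2, (LinearMap.pi fun js : Fin 2 × ι =>
        if js.1 = i then (LinearMap.proj js.2 : (ι → F) →ₗ[F] F) else 0) (fun s => z (i, s)) := by
      funext ⟨j, s⟩
      rw [Finset.sum_apply, Finset.sum_eq_single j]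
      · simp
      · intro i _ hi
        simp [hi.symm]
      · simp
    rw [hsum]
    exact Submodule.sum_mem _ fun i _ => hemb i (hz i)

/-- The dot product is the nondegenerate symmetric form of the identity matrix, so the double
orthogonal of a subspace is itself. -/
theorem dualCode_dualCode {ι : Type*} [Fintype ι] [DecidableEq ι] (C : Submodule F (ι → F)) :
    dualCode (dualCode C) = C := by
  have key (D : Submodule F (ι → F)) :
      dualCode D = (Matrix.toBilin' (1 : Matrix ι ι F)).orthogonal D := by
    ext y
    rw [LinearMap.BilinForm.mem_orthogonal_iff]
    refine forall₂_congr fun x _ => ?_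
    rw [Matrix.toBilin'_apply', Matrix.one_mulVec]
  rw [key, key]
  refine LinearMap.BilinForm.orthogonal_orthogonal ?_ ?_ C
  · exact LinearMap.BilinForm.nondegenerate_toBilin'_of_det_ne_zero' 1 (by simp)
  · intro x y h
    rw [Matrix.toBilin'_apply', Matrix.one_mulVec] at h ⊢
    rwa [dotProduct_comm]

/-- The form pairs the clock copy of one vector with the shift copy of the other. Since `D` is
`F`-linear, rescaling its words removes the trace. -/
theorem sympDual_codeProd (p : ℕ) [Fact p.Prime] [Algebra (ZMod p) F] [Fintype F] [DecidableEq F]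
    {n : ℕ} (D : Submodule F (Fin n → F)) :
    sympDual p (codeProd D) = codeProd (dualCode D) := by
  ext w
  constructor
  · intro hw i x hx
    by_contra hne
    obtain ⟨b, hb⟩ := exists_trace_mul_ne_zero p hne
    -- The test vector sits in the copy opposite to `i`, scaled by `b` so that the trace detects the
    -- nonzero dot product.
    let v : Fin 2 × Fin n → F := fun js => if js.1 = i then 0 else b * x js.2
    have hv : v ∈ codeProd D := by
      intro j
      by_cases hj : j = i
      · simp only [v, if_pos hj]
        exact D.zero_mem
      · simp only [v, if_neg hj]
        exact D.smul_mem b hx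
    have h := hw v hv
    rw [symp_eq] at h
    fin_cases i
    · have h1 : fstPart v = 0 := rfl
      have h2 : sndPart v = b • x := rfl
      rw [h1, h2, zero_dotProduct, sub_zero, smul_dotProduct, smul_eq_mul, mul_comm] at h
      exact hb h
    · have h1 : sndPart v = 0 := rfl
      have h2 : fstPart v = b • x := rfl
      rw [h1, h2, zero_dotProduct, zero_sub, map_neg, neg_eq_zero, smul_dotProduct, smul_eq_mul,
        mul_comm] at h
      exact hb h
  · intro hw v hv
    have h0 : sndPart v ⬝ᵥ fstPart w = 0 := hw 0 _ (hv 1)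
    have h1 : fstPart v ⬝ᵥ sndPart w = 0 := hw 1 _ (hv 0)
    rw [symp_eq, h0, h1, sub_zero, map_zero]

theorem spaceV_eq_codeProd {n a b : ℕ} {H : Matrix (Fin a) (Fin n) F}
    {F' : Matrix (Fin b) (Fin n) F} {C : Submodule F (Fin n → F)} (hH : IsParityCheckMatrix H C) :
    spaceV H F' = codeProd (dualCode C) :=
  (IsGeneratorMatrix.diagTwo hH).2

/-- Regrouping rows turns `starGen H F'` into the block diagonal of the stacked matrix. -/
theorem isGeneratorMatrix_starGen {n a b : ℕ} {H : Matrix (Fin a) (Fin n) F}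
    {F' : Matrix (Fin b) (Fin n) F} {C : Submodule F (Fin n → F)}
    (h : IsGeneratorMatrix (Matrix.fromRows H F') C) :
    IsGeneratorMatrix (starGen H F') (codeProd C) := by
  have h1 := h.diagTwo.reindex (Equiv.prodSumDistrib (Fin 2) (Fin a) (Fin b)).symm
  convert h1 using 1
  ext (i | i) j <;> rfl

end CodeLemmas

/-! ### Arithmetic of the cyclic target sets. -/

section Targets

variable {n k t : ℕ}

theorem lcm_div_mul_gcd (a b : ℕ) (hb : 0 < b) : Nat.lcm a b / b * Nat.gcd a b = a := by
  obtain ⟨q, hq⟩ := Nat.dvd_lcm_right a b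
  rw [hq, Nat.mul_div_cancel_left _ hb]
  have h := Nat.gcd_mul_lcm a b
  rw [hq] at h
  exact Nat.eq_of_mul_eq_mul_left hb (by linarith)

theorem blocks_mul_gcd (n t : ℕ) (hk : 1 ≤ k) :
    blocks n k t * Nat.gcd (cPar n k t) k = cPar n k t :=
  lcm_div_mul_gcd _ _ hk

/-- The interval length is `gcd (c, k)`, symmetric in `c` and `k`; this gives both `β g = c` and `ρ
g = k`. -/
theorem cPar_div_blocks (n t : ℕ) (hk : 1 ≤ k) :
    cPar n k t / blocks n k t = Nat.gcd (cPar n k t) k := by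
  have h := blocks_mul_gcd n t hk
  have h0 : 0 < blocks n k t := Nat.pos_of_ne_zero fun h0 => by
    rw [h0, zero_mul] at h
    exact Nat.succ_ne_zero _ h.symm
  exact Nat.div_eq_of_eq_mul_right h0 h.symm

theorem blocks_mul_div (n t : ℕ) (hk : 1 ≤ k) :
    blocks n k t * (cPar n k t / blocks n k t) = cPar n k t := by
  rw [cPar_div_blocks n t hk, blocks_mul_gcd n t hk]

theorem rounds_mul_div (n t : ℕ) (hk : 1 ≤ k) :
    rounds n k t * (cPar n k t / blocks n k t) = k := by
  rw [cPar_div_blocks n t hk, rounds, Nat.lcm_comm, Nat.gcd_comm]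
  exact lcm_div_mul_gcd _ _ (Nat.succ_pos _)

/-- The pairs `(x, j)`, `x < u`, `j < g`, enumerate a cyclic window of `u * g ≤ d` residues. -/
theorem window_injective {d e u g : ℕ} (h : u * g ≤ d) {x y : Fin u} {i j : Fin g}
    (hxy : (e + (x.val * g + i.val)) % d = (e + (y.val * g + j.val)) % d) : x = y ∧ i = j := by
  have hlt (x : Fin u) (i : Fin g) : x.val * g + i.val < d := by
    have h1 : (x.val + 1) * g ≤ u * g := Nat.mul_le_mul_right g x.2
    have h2 := i.2
    rw [add_mul, one_mul] at h1
    omega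
  -- Both offsets are below `d`, so congruence is equality; division by `g` then separates the two
  -- indices.
  have h1 : x.val * g + i.val = y.val * g + j.val :=
    Nat.ModEq.eq_of_lt_of_lt (Nat.ModEq.add_left_cancel' e hxy) (hlt x i) (hlt y j)
  have hg : 0 < g := i.pos
  have hx : (x.val * g + i.val) / g = x.val := by
    rw [mul_comm, Nat.mul_add_div hg, Nat.div_eq_of_lt i.2, add_zero]
  have hy : (y.val * g + j.val) / g = y.val := by
    rw [mul_comm, Nat.mul_add_div hg, Nat.div_eq_of_lt j.2, add_zero]
  have h2 : x.val = y.val := by rw [← hx, h1, hy]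
  rw [h2] at h1
  exact ⟨Fin.ext h2, Fin.ext (by omega)⟩

/-- The `j`-th server from which a symbol of block `b` is obtained in round `r`. -/
def targetPos (hk : 1 ≤ k) (hkn : k ≤ n) (r : Fin (rounds n k t)) (b : Fin (blocks n k t))
    (j : Fin (cPar n k t / blocks n k t)) : Fin n :=
  ⟨((b.val + r.val) * (cPar n k t / blocks n k t) + j) % max (cPar n k t) k, by
    have h : 0 < max (cPar n k t) k := lt_max_of_lt_right hk
    refine (Nat.mod_lt _ h).trans_le (max_le ?_ hkn)
    have h1 : cPar n k t = n - k - t + 1 := rfl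
    omega⟩

theorem mem_targets_iff (hk : 1 ≤ k) (hkn : k ≤ n)
    (r : Fin (rounds n k t)) (b : Fin (blocks n k t)) (s : Fin n) :
    s ∈ targets n k t r b ↔ ∃ j, targetPos hk hkn r b j = s := by
  simp only [targets, Finset.mem_filter, Finset.mem_univ, true_and]
  constructor
  · rintro ⟨j, hj, h⟩
    exact ⟨⟨j, hj⟩, Fin.ext h.symm⟩
  · rintro ⟨j, rfl⟩
    exact ⟨j, j.2, rfl⟩

/-- For fixed `r` the positions fill a cyclic window of `β g = c` residues starting at `r g`, too
short to wrap onto itself. -/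
theorem targetPos_injective_block (hk : 1 ≤ k) (hkn : k ≤ n)
    (r : Fin (rounds n k t)) {b b' : Fin (blocks n k t)}
    {j j' : Fin (cPar n k t / blocks n k t)}
    (h : targetPos hk hkn r b j = targetPos hk hkn r b' j') : b = b' ∧ j = j' := by
  have h1 := congrArg Fin.val h
  refine window_injective (e := r.val * (cPar n k t / blocks n k t))
    ((blocks_mul_div n t hk).le.trans (le_max_left _ k)) ?_
  have e1 (b : Fin (blocks n k t)) (j : ℕ) :
      r.val * (cPar n k t / blocks n k t) + (b.val * (cPar n k t / blocks n k t) + j) =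
      (b.val + r.val) * (cPar n k t / blocks n k t) + j := by ring
  rw [e1, e1]
  exact h1

/-- For fixed `b` the window starts at `b g` and has `ρ g = k` residues. -/
theorem targetPos_injective_round (hk : 1 ≤ k) (hkn : k ≤ n)
    (b : Fin (blocks n k t)) {r r' : Fin (rounds n k t)}
    {j j' : Fin (cPar n k t / blocks n k t)}
    (h : targetPos hk hkn r b j = targetPos hk hkn r' b j') : r = r' ∧ j = j' := by
  have h1 := congrArg Fin.val h
  refine window_injective (e := b.val * (cPar n k t / blocks n k t))
    ((rounds_mul_div n t hk).le.trans (le_max_right (cPar n k t) _)) ?_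
  have e1 (r : Fin (rounds n k t)) (j : ℕ) :
      b.val * (cPar n k t / blocks n k t) + (r.val * (cPar n k t / blocks n k t) + j) =
      (b.val + r.val) * (cPar n k t / blocks n k t) + j := by ring
  rw [e1, e1]
  exact h1

theorem target_injective (hk : 1 ≤ k) (hkn : k ≤ n)
    (r : Fin (rounds n k t)) :
    Function.Injective fun a : TIdx n k t r => a.2.1 := by
  rintro ⟨b, s, hs⟩ ⟨b', s', hs'⟩ h
  obtain ⟨j, hj⟩ := (mem_targets_iff hk hkn r b s).mp hs
  obtain ⟨j', hj'⟩ := (mem_targets_iff hk hkn r b' s').mp hs'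
  obtain rfl : s = s' := h
  obtain ⟨rfl, -⟩ := targetPos_injective_block hk hkn r (hj.trans hj'.symm)
  rfl

theorem card_TIdx (hk : 1 ≤ k) (hkn : k ≤ n)
    (r : Fin (rounds n k t)) : Fintype.card (TIdx n k t r) = cPar n k t := by
  let f : Fin (blocks n k t) × Fin (cPar n k t / blocks n k t) → TIdx n k t r := fun x =>
    ⟨x.1, targetPos hk hkn r x.1 x.2, (mem_targets_iff hk hkn r _ _).mpr ⟨_, rfl⟩⟩
  have hf : Function.Bijective f := by
    constructor
    · rintro ⟨b, j⟩ ⟨b', j'⟩ h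
      have h1 : targetPos hk hkn r b j = targetPos hk hkn r b' j' :=
        congrArg (fun a : TIdx n k t r => a.2.1) h
      obtain ⟨rfl, rfl⟩ := targetPos_injective_block hk hkn r h1
      rfl
    · rintro ⟨b, s, hs⟩
      obtain ⟨j, rfl⟩ := (mem_targets_iff hk hkn r b s).mp hs
      exact ⟨(b, j), rfl⟩
  rw [← Fintype.card_of_bijective hf, Fintype.card_prod, Fintype.card_fin, Fintype.card_fin,
    blocks_mul_div n t hk]

/-- Over all rounds, each block is retrieved from `k` servers. -/
theorem card_biUnion_targets (hk : 1 ≤ k) (hkn : k ≤ n)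
    (b : Fin (blocks n k t)) :
    k ≤ (Finset.univ.biUnion fun r => targets n k t r b).card := by
  let f : Fin (rounds n k t) × Fin (cPar n k t / blocks n k t) → Fin n := fun x =>
    targetPos hk hkn x.1 b x.2
  have hf : Function.Injective f := by
    rintro ⟨r, j⟩ ⟨r', j'⟩ h
    obtain ⟨rfl, rfl⟩ := targetPos_injective_round hk hkn b h
    rfl
  calc k = (Finset.univ.image f).card := by
        rw [Finset.card_image_of_injective _ hf, Finset.card_univ, Fintype.card_prod,
          Fintype.card_fin, Fintype.card_fin, rounds_mul_div n t hk]
    _ ≤ _ := by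
        refine Finset.card_le_card fun s hs => ?_
        obtain ⟨⟨r, j⟩, -, rfl⟩ := Finset.mem_image.mp hs
        exact Finset.mem_biUnion.mpr
          ⟨r, Finset.mem_univ r, (mem_targets_iff hk hkn r b _).mpr ⟨j, rfl⟩⟩

end Targets

/-! ### Responses modulo the star product code, and recovery of the file. -/

section Retrieval

variable {F : Type*} [Field F] {n k t m : ℕ}

theorem vecMul_targetN_target {r : Fin (rounds n k t)}
    (hinj : Function.Injective fun a : TIdx n k t r => a.2.1) (c : TIdx n k t r → F)
    (a : TIdx n k t r) : (c ᵥ* targetN F n k t r) a.2.1 = c a := by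
  simp only [Matrix.vecMul, dotProduct, targetN, Matrix.of_apply]
  rw [Finset.sum_eq_single a]
  · simp
  · intro a' _ ha'
    rw [if_neg fun h => ha' (hinj h), mul_zero]
  · simp

theorem vecMul_targetN_eq_zero {r : Fin (rounds n k t)} (c : TIdx n k t r → F) {s : Fin n}
    (hs : ∀ a : TIdx n k t r, a.2.1 ≠ s) : (c ᵥ* targetN F n k t r) s = 0 := by
  simp only [Matrix.vecMul, dotProduct, targetN, Matrix.of_apply]
  exact Finset.sum_eq_zero fun a _ => by rw [if_neg (hs a), mul_zero]

/-- A vector supported on the targeted servers in a code of dimension `n - c` vanishes. -/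
theorem eq_zero_of_vecMul_targetN_mem (hk : 1 ≤ k) (hkn : k ≤ n) (hkt : k + t - 1 < n)
    {C : Submodule F (Fin n → F)} (hC : IsGRS (k + t - 1) C) {r : Fin (rounds n k t)}
    {c : TIdx n k t r → F} (hc : c ᵥ* targetN F n k t r ∈ C) : c = 0 := by
  have hinj := target_injective hk hkn r
  have h0 : c ᵥ* targetN F n k t r = 0 := by
    -- The untargeted servers number `n - c = k + t - 1`, the dimension of the code.
    refine hC.eq_zero hc (Finset.univ.image fun a : TIdx n k t r => a.2.1)ᶜ ?_ fun s hs => ?_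
    · rw [Finset.card_compl, Finset.card_image_of_injective _ hinj, Finset.card_univ,
        card_TIdx hk hkn r, Fintype.card_fin]
      have : cPar n k t = n - k - t + 1 := rfl
      omega
    · refine vecMul_targetN_eq_zero c fun a ha => ?_
      exact Finset.mem_compl.mp hs (Finset.mem_image.mpr ⟨a, Finset.mem_univ a, ha⟩)
  funext a
  rw [← vecMul_targetN_target hinj c a, h0]
  rfl

/-- Injectivity holds copy by copy; surjectivity follows because both spaces have dimension `2c`. -/
theorem bijective_mkQ_vecMul_targetM (hk : 1 ≤ k) (ht : 1 ≤ t) (hkn : k ≤ n) (hkt : k + t - 1 < n)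
    {C : Submodule F (Fin n → F)} (hC : IsGRS (k + t - 1) C)
    (hrank : Module.finrank F (codeProd C) = 2 * (k + t - 1)) (r : Fin (rounds n k t)) :
    Function.Bijective fun o : Fin 2 × TIdx n k t r → F =>
      (codeProd C).mkQ (o ᵥ* targetM F n k t r) := by
  let L := (codeProd C).mkQ ∘ₗ (targetM F n k t r).vecMulLinear
  have hL : Function.Injective L := by
    rw [← LinearMap.ker_eq_bot, LinearMap.ker_eq_bot']
    intro o ho
    have h1 : o ᵥ* targetM F n k t r ∈ codeProd C := (Submodule.Quotient.mk_eq_zero _).mp ho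
    funext ⟨i, a⟩
    have h2 := h1 i
    simp only [targetM, vecMul_diagTwo] at h2
    exact congrFun (eq_zero_of_vecMul_targetN_mem hk hkn hkt hC h2) a
  have hfin : Module.finrank F (Fin 2 × TIdx n k t r → F) =
      Module.finrank F ((Fin 2 × Fin n → F) ⧸ codeProd C) := by
    have h1 := Submodule.finrank_quotient_add_finrank (codeProd C)
    rw [hrank, Module.finrank_fintype_fun_eq_card, Fintype.card_prod, Fintype.card_fin,
      Fintype.card_fin] at h1
    rw [Module.finrank_fintype_fun_eq_card, Fintype.card_prod, card_TIdx hk hkn r,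
      Fintype.card_fin]
    have : cPar n k t = n - k - t + 1 := rfl
    omega
  exact ⟨hL, (LinearMap.injective_iff_surjective_of_finrank_eq_finrank hfin).mp hL⟩

theorem row_mul_diagTwo_mem {μ κ ι : Type*} [Fintype κ] {G : Matrix κ ι F}
    {C : Submodule F (ι → F)} (hG : IsGeneratorMatrix G C) (X : Matrix μ (Fin 2 × κ) F) (i : μ) :
    (fun js => (X * diagTwo G) i js) ∈ codeProd C :=
  ((isGeneratorMatrix_iff.mp hG.diagTwo).2 _).mpr ⟨X i, rfl⟩

theorem response_eq {C D : Submodule F (Fin n → F)} {GC : Matrix (Fin k) (Fin n) F}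
    (hGC : IsGeneratorMatrix GC C) {GD : Matrix (Fin t) (Fin n) F} (hGD : IsGeneratorMatrix GD D)
    (X : Matrix (Fin m × Fin (blocks n k t)) (Fin 2 × Fin k) F) (K : Fin m)
    (r : Fin (rounds n k t)) (Z : Matrix (Fin m × Fin (blocks n k t)) (Fin 2 × Fin t) F) :
    ∃ s ∈ starProd (codeProd C) (codeProd D),
      response GC GD X K r Z = s + desired GC X K r ᵥ* targetM F n k t r := by
  -- The masking part: for each row, a stored codeword times the random codeword of the query.
  refine ⟨∑ ib, fun js => stored GC X ib js * (Z * diagTwo GD) ib js, ?_, ?_⟩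
  · exact Submodule.sum_mem _ fun ib _ => Submodule.subset_span
      ⟨_, row_mul_diagTwo_mem hGC X ib, _, row_mul_diagTwo_mem hGD Z ib, rfl⟩
  · funext js
    simp only [response, query, dotProduct, Matrix.add_apply, mul_add, Finset.sum_add_distrib,
      Pi.add_apply, Finset.sum_apply]
    congr 1
    simp only [Matrix.mul_apply, Matrix.vecMul, dotProduct, Finset.mul_sum]
    rw [Finset.sum_comm]
    refine Finset.sum_congr rfl fun pa _ => ?_
    -- The column of `E_(K)` at `pa` selects this row alone.
    rw [Finset.sum_eq_single (K, pa.2.1)]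
    · obtain ⟨i, a⟩ := pa
      obtain ⟨j, s⟩ := js
      simp only [selectE, targetM, diagTwo, targetN, desired, Matrix.of_apply, if_true, one_mul]
      by_cases h1 : i = j
      · by_cases h2 : a.2.1 = s
        · rw [h1, h2]
        · simp [h2]
      · simp [h1]
    · intro ib _ hib
      simp [selectE, hib]
    · simp

/-- In each block and copy, two encodings agreeing at the retrieved servers differ by a codeword of
`C'` with at least `k` zeros, so they coincide; encoding is injective. -/
theorem solvesSystem_desired_iff (hk : 1 ≤ k) {C : Submodule F (Fin n → F)} (hC : IsGRS k C)
    {GC : Matrix (Fin k) (Fin n) F} (hGC : IsGeneratorMatrix GC C)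
    (X : Matrix (Fin m × Fin (blocks n k t)) (Fin 2 × Fin k) F) (K : Fin m)
    (x : Matrix (Fin (blocks n k t)) (Fin 2 × Fin k) F) :
    SolvesSystem GC (desired GC X K) x ↔ x = file X K := by
  have hst (b : Fin (blocks n k t)) (js : Fin 2 × Fin n) :
      stored GC X (K, b) js = (file X K * diagTwo GC) b js := rfl
  constructor
  · intro hx
    funext b
    refine (isGeneratorMatrix_iff.mp hGC.diagTwo).1 ?_
    change (x * diagTwo GC) b = (file X K * diagTwo GC) b
    funext ⟨i, s⟩
    have hmem : (fun s => (x * diagTwo GC) b (i, s) - (file X K * diagTwo GC) b (i, s)) ∈ C :=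
      C.sub_mem (row_mul_diagTwo_mem hGC x b i) (row_mul_diagTwo_mem hGC (file X K) b i)
    have h0 := hC.eq_zero hmem _ (card_biUnion_targets hk hC.1 b) fun s hs => by
      obtain ⟨r, -, hr⟩ := Finset.mem_biUnion.mp hs
      have h1 := hx r (i, ⟨b, s, hr⟩)
      simp only [desired, hst] at h1
      rw [h1, sub_self]
    exact sub_eq_zero.mp (congrFun h0 s)
  · rintro rfl r pa
    rfl

end Retrieval

/-! ### Measurement statistics. -/

section Correctness

variable {F : Type*} [Field F] [Fintype F] [DecidableEq F]
variable {p : ℕ} [Fact p.Prime] [Algebra (ZMod p) F] {n k t m : ℕ}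
variable {V : Submodule F (Fin 2 × Fin n → F)} (E : WeylLift p V)
variable {S : Subgroup (Matrix.unitaryGroup (Fin n → F) ℂ)}

theorem isPVM_stabProj
    (hE : ∀ w, stabProj p S V ((sympDual p V).mkQ w) = E.proj w)
    (hcard : Nat.card ((Fin 2 × Fin n → F) ⧸ sympDual p V) = Nat.card V) :
    IsPVM (stabProj p S V) := by
  have hmk (w : (Fin 2 × Fin n → F) ⧸ sympDual p V) : (sympDual p V).mkQ w.out = w :=
    Quotient.out_eq _
  have hP (w) : stabProj p S V w = E.proj w.out := by rw [← hE, hmk]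
  have := Fintype.ofFinite ((Fin 2 × Fin n → F) ⧸ sympDual p V)
  refine ⟨fun w => ?_, fun w w' hne => ?_, ?_⟩
  · rw [hP]
    exact ⟨E.proj_isHermitian _, E.proj_mul_self _⟩
  · rw [hP, hP, E.proj_mul_proj, hmk, hmk, if_neg hne]
  · rw [finsum_eq_sum_of_fintype, Finset.sum_congr rfl fun w _ => hP w, E.sum_proj hcard]

/-- Since `|V| = q ^ (2c)`, the projector has trace `q ^ (n - 2c)`, and `n - 2(k + t - 1) = 2c - n`.
The bounds on `k` and `t` make the truncated subtraction in `c` exact. -/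
theorem card_zpow_mul_trace (hV : Module.finrank F V = 2 * (n - k - t + 1)) (hk : 1 ≤ k)
    (hkt : k + t - 1 < n) :
    ((Fintype.card F : ℂ) ^ ((n : ℤ) - 2 * ((k : ℤ) + t - 1))) *
      ((Nat.card V : ℂ)⁻¹ * (Fintype.card F : ℂ) ^ n) = 1 := by
  have hq : (Fintype.card F : ℂ) ≠ 0 := by exact_mod_cast Fintype.card_ne_zero
  rw [Module.natCard_eq_pow_finrank (K := F), hV, Nat.card_eq_fintype_card, Nat.cast_pow,
    ← zpow_natCast, ← zpow_natCast, ← zpow_neg, ← zpow_add₀ hq, ← zpow_add₀ hq]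
  have : (n : ℤ) - 2 * ((k : ℤ) + t - 1) + (-((2 * (n - k - t + 1) : ℕ) : ℤ) + (n : ℤ)) = 0 := by
    omega
  rw [this, zpow_zero]

theorem isDensity_initialState
    (hE : ∀ w, stabProj p S V ((sympDual p V).mkQ w) = E.proj w)
    (hV : Module.finrank F V = 2 * (n - k - t + 1)) (hk : 1 ≤ k) (hkt : k + t - 1 < n) :
    IsDensity (initialState p n k t S V) := by
  have h0 : stabProj p S V 0 = E.proj 0 := by rw [← hE, map_zero]
  rw [initialState, h0]
  refine ⟨(E.proj_posSemidef 0).smul (zpow_nonneg (Nat.cast_nonneg _) _), ?_⟩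
  rw [Matrix.trace_smul, E.trace_proj, smul_eq_mul, card_zpow_mul_trace hV hk hkt]

/-- The received state is the normalized projector labelled by `d · M^{(r)}`, as `s` disappears in
the quotient. Against the projector of `o` it has trace `1` or `0`, and injectivity turns equality
of cosets into `o = d`. -/
theorem outputProb_eq
    (hE : ∀ w, stabProj p S V ((sympDual p V).mkQ w) = E.proj w)
    (hV : Module.finrank F V = 2 * (n - k - t + 1)) (hk : 1 ≤ k) (hkt : k + t - 1 < n)
    (r : Fin (rounds n k t))
    (hM : Function.Injective fun o : Fin 2 × TIdx n k t r → F =>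
      (sympDual p V).mkQ (o ᵥ* targetM F n k t r))
    {A s : Fin 2 × Fin n → F} {d : Fin 2 × TIdx n k t r → F} (hs : s ∈ sympDual p V)
    (hA : A = s + d ᵥ* targetM F n k t r) (o : Fin 2 × TIdx n k t r → F) :
    outputProb p S V A r o = if o = d then 1 else 0 := by
  have h0 : stabProj p S V 0 = E.proj 0 := by rw [← hE, map_zero]
  have hAq : (sympDual p V).mkQ A = (sympDual p V).mkQ (d ᵥ* targetM F n k t r) := by
    rw [hA, map_add, show (sympDual p V).mkQ s = 0 from (Submodule.Quotient.mk_eq_zero _).mpr hs,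
      zero_add]
  rw [outputProb, receivedState, initialState, hE, h0, serversOp_eq_weyl, Matrix.mul_smul,
    Matrix.smul_mul, E.weyl_conj_proj, zero_add, Matrix.mul_smul, Matrix.trace_smul,
    E.proj_mul_proj, hAq]
  by_cases h : o = d
  · rw [if_pos h, if_pos (by rw [h]), E.trace_proj, smul_eq_mul, card_zpow_mul_trace hV hk hkt,
      Complex.one_re]
  · rw [if_neg h, if_neg fun h' => h (hM h'), Matrix.trace_zero, smul_zero, Complex.zero_re]

theorem successProb_eq_one {GC : Matrix (Fin k) (Fin n) F} {GD : Matrix (Fin t) (Fin n) F}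
    {X : Matrix (Fin m × Fin (blocks n k t)) (Fin 2 × Fin k) F} {K : Fin m}
    {Z : Fin (rounds n k t) → Matrix (Fin m × Fin (blocks n k t)) (Fin 2 × Fin t) F}
    (hout : ∀ (r : Fin (rounds n k t)) (o : Fin 2 × TIdx n k t r → F),
      outputProb p S V (response GC GD X K r (Z r)) r o =
        if o = desired GC X K r then 1 else 0)
    (hsolve : ∀ x, SolvesSystem GC (desired GC X K) x ↔ x = file X K) :
    successProb p GC GD S V X K Z = 1 := by
  classical
  rw [successProb, Finset.sum_eq_single (desired GC X K)]
  · rw [if_pos hsolve]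
    exact Finset.prod_eq_one fun r _ => by rw [hout, if_pos rfl]
  · intro o _ ho
    obtain ⟨r, hr⟩ := Function.ne_iff.mp ho
    rw [Finset.prod_eq_zero (Finset.mem_univ r) (by rw [hout, if_neg hr]), ite_self]
  · simp

end Correctness

end CodedQPIR

end

/-! ### Assembly of the correctness lemma. -/

theorem mainTheorem2
    {F : Type*} [Field F] [Fintype F] [DecidableEq F]
    (p : ℕ) [Fact p.Prime] [Algebra (ZMod p) F]
    (n k t : ℕ) (hk : 1 ≤ k) (ht : 1 ≤ t)
    (hn : n ≤ 2 * (k + t - 1)) (hkt : k + t - 1 < n)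
    (C' D' : Submodule F (Fin n → F))
    (hC' : CodedQPIR.IsGRS k C') (hD' : CodedQPIR.IsGRS t D')
    (hS' : CodedQPIR.IsGRS (k + t - 1) (CodedQPIR.starProd C' D'))
    (hdual : CodedQPIR.WeaklySelfDual (CodedQPIR.starProd C' D'))
    (GC : Matrix (Fin k) (Fin n) F) (hGC : CodedQPIR.IsGeneratorMatrix GC C')
    (GD : Matrix (Fin t) (Fin n) F) (hGD : CodedQPIR.IsGeneratorMatrix GD D')
    (H : Matrix (Fin (n - k - t + 1)) (Fin n) F)
    (hH : CodedQPIR.IsParityCheckMatrix H (CodedQPIR.starProd C' D'))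
    (F' : Matrix (Fin (2 * (k + t - 1) - n)) (Fin n) F)
    (hF' : CodedQPIR.IsGeneratorMatrix (Matrix.fromRows H F') (CodedQPIR.starProd C' D')) :
    -- the space `V` is self-orthogonal, and its dual is the row space of `G_S`, which is `S = C ⋆ D`
    CodedQPIR.spaceV H F' ≤ CodedQPIR.sympDual p (CodedQPIR.spaceV H F') ∧
    CodedQPIR.IsGeneratorMatrix (CodedQPIR.starGen H F')
      (CodedQPIR.sympDual p (CodedQPIR.spaceV H F')) ∧
    CodedQPIR.sympDual p (CodedQPIR.spaceV H F') =
      CodedQPIR.starProd (CodedQPIR.codeProd C') (CodedQPIR.codeProd D') ∧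
    -- the cosets of `V^{⊥_J}` are uniquely represented by the vectors `o · M^{(r)}`, `o ∈ F^{2c}`
    (∀ r : Fin (CodedQPIR.rounds n k t),
      Fintype.card (CodedQPIR.TIdx n k t r) = n - k - t + 1 ∧
      Function.Bijective fun o : Fin 2 × CodedQPIR.TIdx n k t r → F =>
        (CodedQPIR.sympDual p (CodedQPIR.spaceV H F')).mkQ
          (Matrix.vecMul o (CodedQPIR.targetM F n k t r))) ∧
    -- the response vector is in `S` plus the desired symbols encoded by `M^{(r)}`
    (∀ (m : ℕ) (K : Fin m)
      (X : Matrix (Fin m × Fin (CodedQPIR.blocks n k t)) (Fin 2 × Fin k) F)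
      (r : Fin (CodedQPIR.rounds n k t))
      (Z : Matrix (Fin m × Fin (CodedQPIR.blocks n k t)) (Fin 2 × Fin t) F),
      ∃ s ∈ CodedQPIR.starProd (CodedQPIR.codeProd C') (CodedQPIR.codeProd D'),
        CodedQPIR.response GC GD X K r Z =
          s + Matrix.vecMul (CodedQPIR.desired GC X K r) (CodedQPIR.targetM F n k t r)) ∧
    -- a stabilizer group of `V` exists, and with any of them the scheme is correct
    (∃ S, CodedQPIR.IsStabilizerOf p S (CodedQPIR.spaceV H F')) ∧
    ∀ S, CodedQPIR.IsStabilizerOf p S (CodedQPIR.spaceV H F') →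
      CodedQPIR.IsPVM (CodedQPIR.stabProj p S (CodedQPIR.spaceV H F')) ∧
      CodedQPIR.IsDensity (CodedQPIR.initialState p n k t S (CodedQPIR.spaceV H F')) ∧
      ∀ (m : ℕ) (K : Fin m)
        (X : Matrix (Fin m × Fin (CodedQPIR.blocks n k t)) (Fin 2 × Fin k) F)
        (Z : Fin (CodedQPIR.rounds n k t) →
          Matrix (Fin m × Fin (CodedQPIR.blocks n k t)) (Fin 2 × Fin t) F),
        -- in each round, the output is the vector of desired symbols with probability one
        (∀ (r : Fin (CodedQPIR.rounds n k t)) (o : Fin 2 × CodedQPIR.TIdx n k t r → F),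
          CodedQPIR.outputProb p S (CodedQPIR.spaceV H F')
              (CodedQPIR.response GC GD X K r (Z r)) r o =
            if o = CodedQPIR.desired GC X K r then 1 else 0) ∧
        -- these symbols determine the file by a linear system
        (∀ x, CodedQPIR.SolvesSystem GC (CodedQPIR.desired GC X K) x ↔
          x = CodedQPIR.file X K) ∧
        -- the file is recovered without error
        CodedQPIR.successProb p GC GD S (CodedQPIR.spaceV H F') X K Z = 1 := by
  have hkn : k ≤ n := hC'.1
  have hV : CodedQPIR.spaceV H F' =
      CodedQPIR.codeProd (CodedQPIR.dualCode (CodedQPIR.starProd C' D')) :=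
    CodedQPIR.spaceV_eq_codeProd hH
  have hVd : CodedQPIR.sympDual p (CodedQPIR.spaceV H F') =
      CodedQPIR.codeProd (CodedQPIR.starProd C' D') := by
    rw [hV, CodedQPIR.sympDual_codeProd, CodedQPIR.dualCode_dualCode]
  have hVrank : Module.finrank F (CodedQPIR.spaceV H F') = 2 * (n - k - t + 1) := by
    rw [hV, (CodedQPIR.IsGeneratorMatrix.diagTwo hH).finrank_eq, Fintype.card_prod,
      Fintype.card_fin, Fintype.card_fin]
  have hgen := CodedQPIR.isGeneratorMatrix_starGen hF'
  have hrank : Module.finrank F (CodedQPIR.codeProd (CodedQPIR.starProd C' D')) =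
      2 * (k + t - 1) := by
    rw [hgen.finrank_eq]
    -- The row count is `2c + 2(2(k + t - 1) - n)`; `hn` ensures that the second subtraction does
    -- not truncate.
    simp only [Fintype.card_sum, Fintype.card_prod, Fintype.card_fin]
    omega
  have hbij (r : Fin (CodedQPIR.rounds n k t)) :
      Function.Bijective fun o : Fin 2 × CodedQPIR.TIdx n k t r → F =>
        (CodedQPIR.sympDual p (CodedQPIR.spaceV H F')).mkQ
          (Matrix.vecMul o (CodedQPIR.targetM F n k t r)) := by
    rw [hVd]
    exact CodedQPIR.bijective_mkQ_vecMul_targetM hk ht hkn hkt hS' hrank r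
  have hcard : Nat.card ((Fin 2 × Fin n → F) ⧸
      CodedQPIR.sympDual p (CodedQPIR.spaceV H F')) = Nat.card (CodedQPIR.spaceV H F') := by
    rw [Module.natCard_eq_pow_finrank (K := F),
      Module.natCard_eq_pow_finrank (K := F) (V := CodedQPIR.spaceV H F'), hVrank]
    have h1 := Submodule.finrank_quotient_add_finrank
      (CodedQPIR.sympDual p (CodedQPIR.spaceV H F'))
    rw [hVd, hrank, Module.finrank_fintype_fun_eq_card, Fintype.card_prod, Fintype.card_fin,
      Fintype.card_fin] at h1
    rw [hVd]
    congr 1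
    omega
  have hresp (m : ℕ) (K : Fin m) X (r : Fin (CodedQPIR.rounds n k t)) Z :=
    CodedQPIR.response_eq (m := m) hGC hGD X K r Z
  refine ⟨?_, ?_, ?_, fun r => ⟨CodedQPIR.card_TIdx hk hkn r, hbij r⟩, hresp, ?_, ?_⟩
  · rw [hVd, hV]
    exact fun x hx i => hdual (hx i)
  · rw [hVd]
    exact hgen
  · rw [hVd, CodedQPIR.starProd_codeProd]
  · refine CodedQPIR.exists_isStabilizerOf p _ fun v hv w hw => ?_
    rw [hV] at hv hw
    rw [dotProduct_comm]
    -- The clock part of `v` lies in `S'^⊥` and the shift part of `w` in `S'^⊥ ⊆ S'`, so their dot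
    -- product vanishes even before the trace and no phases are needed.
    exact hv 1 _ (hdual (hw 0))
  · intro S hS
    obtain ⟨E, hE⟩ := hS.exists_weylLift
    have hproj := E.stabProj_eq hE
    refine ⟨CodedQPIR.isPVM_stabProj E hproj hcard,
      CodedQPIR.isDensity_initialState E hproj hVrank hk hkt, fun m K X Z => ?_⟩
    have hout (r : Fin (CodedQPIR.rounds n k t)) (o : Fin 2 × CodedQPIR.TIdx n k t r → F) :
        CodedQPIR.outputProb p S (CodedQPIR.spaceV H F')
          (CodedQPIR.response GC GD X K r (Z r)) r o =
            if o = CodedQPIR.desired GC X K r then 1 else 0 := by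
      obtain ⟨s, hs, hA⟩ := hresp m K X r (Z r)
      rw [CodedQPIR.starProd_codeProd, ← hVd] at hs
      exact CodedQPIR.outputProb_eq E hproj hVrank hk hkt r (hbij r).1 hs hA o
    have hsolve := CodedQPIR.solvesSystem_desired_iff hk hC' hGC X K
    exact ⟨hout, hsolve, CodedQPIR.successProb_eq_one hout hsolve⟩
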